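/- For $w\in S_n$ let $\mathfrak S_w\in\mathbb Z[x_1,\dots,x_n]$ be the Schubert polynomial, that is, $\mathfrak S_{w_0}=x_1^{n-1}x_2^{n-2}\cdots x_{n-1}$ for the longest permutation $w_0$, and $\mathfrak S_w=\partial_i\mathfrak S_{ws_i}$ whenever $w(i)<w(i+1)$, where $s_i=(i,i+1)$ and $\partial_i g=(g-s_ig)/(x_i-x_{i+1})$. Put $\Upsilon_w=\mathfrak S_w(1,\dots,1)$. For positive integers $b_1,\dots,b_k$ with $b_1+\dots+b_k=n$, the layered permutation $w(b_k,\dots,b_1)\in S_n$ is $$(b_k,b_k-1,\dots,1,\;b_k+b_{k-1},\dots,b_k+1,\;\dots,\;n,\dots,n-b_1+1),$$ and we set $b_i=0$ for $i>k$. Let $v(n)$ be the maximum of $\Upsilon_w$ over the layered permutations $w\in S_n$. Let $$f(x)=x^2\log x-\tfrac12(1-x)^2\log(1-x)-\tfrac12(1+x)^2\log(1+x)+2x\log 2 .$$ **Theorem.** The equation $2x f(x)+(1-x^2)f'(x)=0$ has exactly one root $\alpha$ in $(0,1)$. Let $\gamma=f(\alpha)/(1-\alpha^2)$. Then: 1.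 $|\alpha-0.4331818312|<10^{-10}$, $|\gamma-0.2032558981|<10^{-10}$ and $|\gamma/\log 2-0.2932362762|<10^{-10}$. 2. $\displaystyle\lim_{n\to\infty}\frac1{n^2}\log_2 v(n)=\frac{\gamma}{\log 2}$. 3. $|\log v(n)-\gamma n^2|\le 4n$ for all $n\ge1$. 4. If $w(\dots,b_2^{(n)},b_1^{(n)})\in S_n$, $n\ge 0$, are layered permutations with $\Upsilon_{w(\dots,b_2^{(n)},b_1^{(n)})}=v(n)$ for all $n$, then for every fixed $i\ge1$, $b_i^{(n)}\sim\alpha^{i-1}(1-\alpha)\,n$ as $n\to\infty$. 5. More generally, the conclusion of 4 holds for all layered permutations $w(\dots,b_2^{(n)},b_1^{(n)})\in S_n$ with $\log v(n)-\log\Upsilon_{w(\dots,b_2^{(n)},b_1^{(n)})}=o(n)$ as $n\to\infty$. -/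

import Mathlib

open Filter Topology Asymptotics

noncomputable section

namespace LayeredSchubert

/-! ### Schubert polynomials

The variables `x₁, x₂, …` are `X 0, X 1, …`, the positions and values `1, …, n` of a permutation
are `0, …, n - 1 : Fin n`, and the one-line notation of `w` is `w 0, w 1, …`. -/

theorem X_sub_X_dvd (a b : ℕ) (f : MvPolynomial ℕ ℤ) :
    (MvPolynomial.X a - MvPolynomial.X b : MvPolynomial ℕ ℤ) ∣
      f - MvPolynomial.rename (Equiv.swap a b) f := by
  induction f using MvPolynomial.induction_on with
  | C r => simp
  | add p q hp hq =>
    have h : p + q - MvPolynomial.rename (Equiv.swap a b) (p + q) =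
        (p - MvPolynomial.rename (Equiv.swap a b) p) +
          (q - MvPolynomial.rename (Equiv.swap a b) q) := by
      rw [map_add]; ring
    rw [h]
    exact dvd_add hp hq
  | mul_X p c hp =>
    have hX : (MvPolynomial.X a - MvPolynomial.X b : MvPolynomial ℕ ℤ) ∣
        MvPolynomial.X c - MvPolynomial.X (Equiv.swap a b c) := by
      by_cases hca : c = a
      · subst hca; simp
      · by_cases hcb : c = b
        · subst hcb
          rw [Equiv.swap_apply_right]
          exact (dvd_sub_comm).mp (dvd_refl _)
        · rw [Equiv.swap_apply_of_ne_of_ne hca hcb, sub_self]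
          exact dvd_zero _
    have h : p * MvPolynomial.X c - MvPolynomial.rename (Equiv.swap a b) (p * MvPolynomial.X c) =
        (p - MvPolynomial.rename (Equiv.swap a b) p) * MvPolynomial.X c +
          MvPolynomial.rename (Equiv.swap a b) p *
            (MvPolynomial.X c - MvPolynomial.X (Equiv.swap a b c)) := by
      rw [map_mul, MvPolynomial.rename_X]; ring
    rw [h]
    exact dvd_add (Dvd.dvd.mul_right hp _) (Dvd.dvd.mul_left hX _)

/-- The divided difference `(f - s f) / (X i - X (i + 1))`, where `s` exchanges the variables
`X i` and `X (i + 1)`. -/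
def dividedDifference (i : ℕ) (f : MvPolynomial ℕ ℤ) : MvPolynomial ℕ ℤ :=
  (X_sub_X_dvd i (i + 1) f).choose

theorem dividedDifference_spec (i : ℕ) (f : MvPolynomial ℕ ℤ) :
    (MvPolynomial.X i - MvPolynomial.X (i + 1)) * dividedDifference i f =
      f - MvPolynomial.rename (Equiv.swap i (i + 1)) f :=
  (X_sub_X_dvd i (i + 1) f).choose_spec.symm

/-- Positions `i` and `i + 1` form an ascent of `w`. -/
def IsAscent {n : ℕ} (w : Equiv.Perm (Fin n)) (i : ℕ) : Prop :=
  ∃ h : i + 1 < n, w ⟨i, Nat.lt_of_succ_lt h⟩ < w ⟨i + 1, h⟩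

/-- The simple transposition exchanging `i` and `i + 1`. -/
def simpleSwap {n : ℕ} (i : ℕ) (h : i + 1 < n) : Equiv.Perm (Fin n) :=
  Equiv.swap ⟨i, Nat.lt_of_succ_lt h⟩ ⟨i + 1, h⟩

/-- Exchanging the entries of an ascent decreases `∑ j, j * w j`. -/
theorem sum_mul_simpleSwap_lt {n : ℕ} (w : Equiv.Perm (Fin n)) (i : ℕ) (h : i + 1 < n)
    (hw : w ⟨i, Nat.lt_of_succ_lt h⟩ < w ⟨i + 1, h⟩) :
    ∑ j : Fin n, (j : ℕ) * ((w * simpleSwap i h) j : ℕ) < ∑ j : Fin n, (j : ℕ) * (w j : ℕ) := by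
  set a : Fin n := ⟨i, Nat.lt_of_succ_lt h⟩ with ha
  set b : Fin n := ⟨i + 1, h⟩ with hb
  have hab : a ≠ b := by simp [ha, hb]
  have key : ∀ g : Fin n → ℕ, ∑ j, g j = g a + g b + ∑ j ∈ (Finset.univ.erase a).erase b, g j := by
    intro g
    rw [← Finset.add_sum_erase Finset.univ g (Finset.mem_univ a),
      ← Finset.add_sum_erase (Finset.univ.erase a) g
        (Finset.mem_erase.mpr ⟨hab.symm, Finset.mem_univ b⟩), add_assoc]
  rw [key, key (fun j => (j : ℕ) * (w j : ℕ))]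
  have hrest : ∑ j ∈ (Finset.univ.erase a).erase b, (j : ℕ) * ((w * simpleSwap i h) j : ℕ) =
      ∑ j ∈ (Finset.univ.erase a).erase b, (j : ℕ) * (w j : ℕ) := by
    refine Finset.sum_congr rfl fun j hj => ?_
    have hjb : j ≠ b := (Finset.mem_erase.mp hj).1
    have hja : j ≠ a := (Finset.mem_erase.mp (Finset.mem_erase.mp hj).2).1
    rw [Equiv.Perm.mul_apply, simpleSwap, Equiv.swap_apply_of_ne_of_ne hja hjb]
  rw [hrest]
  have h1 : (w * simpleSwap i h) a = w b := by
    rw [Equiv.Perm.mul_apply, simpleSwap, Equiv.swap_apply_left]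
  have h2 : (w * simpleSwap i h) b = w a := by
    rw [Equiv.Perm.mul_apply, simpleSwap, Equiv.swap_apply_right]
  rw [h1, h2]
  have hv : (w a : ℕ) < (w b : ℕ) := hw
  have e1 : (a : ℕ) = i := rfl
  have e2 : (b : ℕ) = i + 1 := rfl
  rw [e1, e2]
  nlinarith

open Classical in
/-- The Schubert polynomial of `w ∈ S_n`, by the Lascoux–Schützenberger recursion:
it is `x₁ⁿ⁻¹ x₂ⁿ⁻² ⋯ xₙ₋₁` for the longest permutation (the only one without ascents), and
`𝔖_w = ∂ᵢ 𝔖_{w sᵢ}` when `w(i) < w(i + 1)`; the recursion uses the first ascent `i` of `w`. -/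
def schubert {n : ℕ} (w : Equiv.Perm (Fin n)) : MvPolynomial ℕ ℤ :=
  if h : ∃ i, IsAscent w i then
    dividedDifference (Nat.find h) (schubert (w * simpleSwap (Nat.find h) (Nat.find_spec h).choose))
  else ∏ i ∈ Finset.range n, MvPolynomial.X i ^ (n - 1 - i)
termination_by ∑ j : Fin n, (j : ℕ) * (w j : ℕ)
decreasing_by
  exact sum_mul_simpleSwap_lt w _ (Nat.find_spec h).choose (Nat.find_spec h).choose_spec

/-- The principal specialization `Υ_w = 𝔖_w(1, …, 1)`. -/
def upsilon {n : ℕ} (w : Equiv.Perm (Fin n)) : ℤ :=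
  MvPolynomial.eval (fun _ => 1) (schubert w)

/-! ### Layered permutations -/

/-- The layered permutation `w(b_k, …, b_1)`, where `(b_k, …, b_1)` are the blocks of the
composition `c` of `n`, in this order: each block of consecutive positions is reversed. -/
def layeredPerm {n : ℕ} (c : Composition n) : Equiv.Perm (Fin n) :=
  (c.blocksFinEquiv.symm.trans (Equiv.sigmaCongrRight fun _ => Fin.revPerm)).trans c.blocksFinEquiv

/-- The run `b_{i+1}` of `(b_k, …, b_1)`, counted from the right; it is `0` if `i ≥ k`. -/
def run {n : ℕ} (c : Composition n) (i : ℕ) : ℕ :=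
  c.blocks.reverse.getD i 0

/-- The set of layered permutations in `S_n`. -/
def layeredPerms (n : ℕ) : Finset (Equiv.Perm (Fin n)) :=
  Finset.univ.image (layeredPerm (n := n))

theorem layeredPerms_nonempty (n : ℕ) : (layeredPerms n).Nonempty :=
  Finset.univ_nonempty.image _

/-- `v(n)`, the maximum of `Υ_w` over the layered permutations `w ∈ S_n`. -/
def v (n : ℕ) : ℤ :=
  (layeredPerms n).sup' (layeredPerms_nonempty n) upsilon

/-! ### The function that defines the constants -/

/-- `f(x) = x² log x - ½ (1-x)² log (1-x) - ½ (1+x)² log (1+x) + 2 x log 2`. -/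
def f (x : ℝ) : ℝ :=
  x ^ 2 * Real.log x - 1 / 2 * (1 - x) ^ 2 * Real.log (1 - x)
    - 1 / 2 * (1 + x) ^ 2 * Real.log (1 + x) + 2 * x * Real.log 2

end LayeredSchubert

end

/-!
The Schubert polynomial of the layered permutation `w(b_k, …, b_1)` factors, block by block, into the
Schubert polynomials of `1_m × w₀(b)` with `b = b_i` and `m = b_{i+1} + ⋯ + b_k`
(`schubert_append_block`): sorting by first ascents first treats the left blocks, by divided
differences in variables in which the last factor is symmetric. The last factor is computed by isobaric
divided differences; these act on the first row of a bordered flagged Jacobi–Trudi determinant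
(`staircasePoly_eq_det`). At `x = 1` the determinant has binomial entries which, up to factors of
the rows, are values of products of linear polynomials; a recursion for these polynomials
evaluates it (`det_kratCoeff`), so that
`Υ = ∏_i F(m_i, b_i)` with `F(m, b) = ∏_{1 ≤ i < j ≤ b} (2 m + i + j - 1) / (i + j - 1)`.

With `n = m + b`, the sum `log F(m, b)` of values of the decreasing convex function
`φ(t) = log ((2 m + t) / t)` over a triangle is compared with the integral of `φ(x + y)` over a
triangle, which equals `n² f(m / n)` exactly. Jensen's inequality on unit squares gives
`log F(m, b) ≤ n² f(m / n)` without an error term (`log_blockValue_le`), and monotonicity gives the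
reverse inequality up to `2 m + b + 1` (`blockIntegral_le`). Integrals are replaced by second
differences of an explicit second antiderivative of `φ`.

The function `f(x) / (1 - x²)` on `(0, 1)` has its unique critical point, a strict maximum with
value `γ`, at `α` (`critFun_zero_unique`, by Rolle's theorem), so
`log F(m, b) ≤ γ (n² - m²)`, which telescopes to `log v(n) ≤ γ n²`. Choosing `m = ⌊α n⌋` repeatedly
gives `log v(n) ≥ γ n² - 4 n`: the errors are at most `4 b` for each block and telescope too.

For the shape of nearly optimal permutations, a block whose ratio `m / n` is not close to `α`
costs `c (n² - m²)`. Hence the total size of the blocks before the first good one is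
bounded (`exists_good_block`), and if it were positive, merging these blocks into
the good one would gain a factor exponential in `n`. So already the first block is good
(`first_block_of_nearly_optimal`), and the remaining blocks form a nearly optimal permutation again.
-/

noncomputable section

namespace LayeredSchubert

/-! ### Divided differences -/

theorem dividedDifference_unique {i : ℕ} {f g : MvPolynomial ℕ ℤ}
    (h : (MvPolynomial.X i - MvPolynomial.X (i + 1)) * g =
      f - MvPolynomial.rename (Equiv.swap i (i + 1)) f) :
    dividedDifference i f = g := by
  have hne : (MvPolynomial.X i - MvPolynomial.X (i + 1) : MvPolynomial ℕ ℤ) ≠ 0 := by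
    rw [sub_ne_zero]
    intro h'
    exact absurd (MvPolynomial.X_injective h') (by simp)
  exact mul_left_cancel₀ hne ((dividedDifference_spec i f).trans h.symm)

theorem dividedDifference_mul {i : ℕ} (f : MvPolynomial ℕ ℤ) {g : MvPolynomial ℕ ℤ}
    (hg : MvPolynomial.rename (Equiv.swap i (i + 1)) g = g) :
    dividedDifference i (f * g) = dividedDifference i f * g := by
  apply dividedDifference_unique
  rw [← mul_assoc, dividedDifference_spec, map_mul, hg]
  ring

theorem dividedDifference_sum {ι : Type*} (s : Finset ι) (i : ℕ) (f : ι → MvPolynomial ℕ ℤ) :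
    dividedDifference i (∑ k ∈ s, f k) = ∑ k ∈ s, dividedDifference i (f k) := by
  apply dividedDifference_unique
  rw [Finset.mul_sum, map_sum, ← Finset.sum_sub_distrib]
  exact Finset.sum_congr rfl fun k _ => dividedDifference_spec i (f k)

/-- The operator `∂_{j+r-1} x_{j+r-1} ⋯ ∂_{j+1} x_{j+1} ∂_j x_j`, a product of isobaric
divided differences. -/
def isobaricChain (j : ℕ) : ℕ → MvPolynomial ℕ ℤ → MvPolynomial ℕ ℤ
  | 0, p => p
  | r + 1, p => dividedDifference (j + r) (MvPolynomial.X (j + r) * isobaricChain j r p)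

theorem isobaricChain_mul {j r : ℕ} (f : MvPolynomial ℕ ℤ) {g : MvPolynomial ℕ ℤ}
    (hg : ∀ q < r, MvPolynomial.rename (Equiv.swap (j + q) (j + q + 1)) g = g) :
    isobaricChain j r (f * g) = isobaricChain j r f * g := by
  induction r with
  | zero => rfl
  | succ r ih =>
    rw [isobaricChain, isobaricChain, ih fun q hq => hg q (by omega), ← mul_assoc,
      dividedDifference_mul _ (hg r (by omega))]

theorem isobaricChain_sum {ι : Type*} (s : Finset ι) (j r : ℕ) (f : ι → MvPolynomial ℕ ℤ) :
    isobaricChain j r (∑ k ∈ s, f k) = ∑ k ∈ s, isobaricChain j r (f k) := by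
  induction r with
  | zero => rfl
  | succ r ih =>
    simp only [isobaricChain]
    rw [ih, Finset.mul_sum, dividedDifference_sum]

/-! ### Complete homogeneous polynomials -/

/-- The geometric series `∑ xᵃ Tᵃ = 1 / (1 - x T)`. -/
def geomSeries {R : Type*} [CommRing R] (x : R) : PowerSeries R :=
  PowerSeries.mk fun a => x ^ a

theorem one_sub_mul_geomSeries {R : Type*} [CommRing R] (x : R) :
    (1 - PowerSeries.C x * PowerSeries.X) * geomSeries x = 1 := by
  ext n
  rw [sub_mul, one_mul, mul_assoc, map_sub, PowerSeries.coeff_C_mul]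
  cases n with
  | zero => simp [geomSeries]
  | succ n =>
    rw [PowerSeries.coeff_succ_X_mul]
    simp [geomSeries, PowerSeries.coeff_one, pow_succ']

theorem map_geomSeries {R S : Type*} [CommRing R] [CommRing S] (φ : R →+* S) (x : R) :
    PowerSeries.map φ (geomSeries x) = geomSeries (φ x) := by
  ext n
  simp [geomSeries]

/-- The generating series `∑ h_a Tᵃ` of the complete homogeneous symmetric polynomials in the
`r + 1` variables `x_j, …, x_{j+r}`. -/
def hSeries (j r : ℕ) : PowerSeries (MvPolynomial ℕ ℤ) :=
  ∏ q ∈ Finset.range (r + 1), geomSeries (MvPolynomial.X (j + q))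

theorem one_sub_mul_hSeries (j r : ℕ) :
    (1 - PowerSeries.C (MvPolynomial.X j : MvPolynomial ℕ ℤ) * PowerSeries.X) * hSeries j (r + 1) =
      hSeries (j + 1) r := by
  rw [hSeries, Finset.prod_range_succ', hSeries, mul_comm, mul_assoc, add_zero, mul_comm (geomSeries _),
    one_sub_mul_geomSeries, mul_one]
  exact Finset.prod_congr rfl fun q _ => by rw [show j + (q + 1) = j + 1 + q by ring]

theorem map_rename_hSeries {j r q : ℕ} (hq : q < r) :
    PowerSeries.map
      ((MvPolynomial.rename (Equiv.swap (j + q) (j + q + 1)) :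
        MvPolynomial ℕ ℤ →ₐ[ℤ] MvPolynomial ℕ ℤ) : MvPolynomial ℕ ℤ →+* MvPolynomial ℕ ℤ)
      (hSeries j r) = hSeries j r := by
  rw [hSeries, map_prod]
  simp only [map_geomSeries, RingHom.coe_coe, MvPolynomial.rename_X]
  refine Finset.prod_bij (fun p _ => Equiv.swap q (q + 1) p) ?_ ?_ ?_ ?_
  · intro p hp
    rw [Finset.mem_range] at hp ⊢
    rw [Equiv.swap_apply_def]
    split_ifs <;> omega
  · intro p _ p' _ h
    exact (Equiv.swap q (q + 1)).injective h
  · intro p hp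
    refine ⟨Equiv.swap q (q + 1) p, ?_, Equiv.swap_apply_self _ _ _⟩
    rw [Finset.mem_range] at hp ⊢
    rw [Equiv.swap_apply_def]
    split_ifs <;> omega
  · intro p _
    congr 2
    rw [Equiv.swap_apply_def, Equiv.swap_apply_def]
    split_ifs <;> omega

/-- The complete homogeneous polynomials in `x_j, …, x_{j+r}` are symmetric, also after a shift
of the degree. -/
theorem rename_coeff_hSeries {j r q : ℕ} (hq : q < r) (a s : ℕ) :
    MvPolynomial.rename (Equiv.swap (j + q) (j + q + 1))
      (PowerSeries.coeff a (PowerSeries.X ^ s * hSeries j r)) =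
      PowerSeries.coeff a (PowerSeries.X ^ s * hSeries j r) := by
  have h := congrArg (PowerSeries.coeff a) (congrArg (PowerSeries.X ^ s * ·)
    (map_rename_hSeries (j := j) hq))
  simp only [PowerSeries.coeff_X_pow_mul', PowerSeries.coeff_map] at h ⊢
  split_ifs with hs
  · rw [if_pos hs, if_pos hs] at h
    exact h
  · exact map_zero _

theorem dividedDifference_X_mul_coeff_hSeries (j r a : ℕ) :
    dividedDifference (j + r) (MvPolynomial.X (j + r) * PowerSeries.coeff a (hSeries j r)) =
      PowerSeries.coeff a (hSeries j (r + 1)) := by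
  apply dividedDifference_unique
  set σ : MvPolynomial ℕ ℤ →+* MvPolynomial ℕ ℤ :=
    ((MvPolynomial.rename (Equiv.swap (j + r) (j + r + 1)) :
        MvPolynomial ℕ ℤ →ₐ[ℤ] MvPolynomial ℕ ℤ) : MvPolynomial ℕ ℤ →+* MvPolynomial ℕ ℤ) with hσ
  set x : MvPolynomial ℕ ℤ := MvPolynomial.X (j + r)
  set y : MvPolynomial ℕ ℤ := MvPolynomial.X (j + r + 1)
  set P : PowerSeries (MvPolynomial ℕ ℤ) :=
    ∏ q ∈ Finset.range r, geomSeries (MvPolynomial.X (j + q)) with hP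
  have hH : hSeries j r = P * geomSeries x := by rw [hSeries, Finset.prod_range_succ]
  have hH' : hSeries j (r + 1) = P * geomSeries x * geomSeries y := by
    rw [hSeries, Finset.prod_range_succ, Finset.prod_range_succ]
    rfl
  have hσx : σ x = y := by simp [hσ, x, y]
  have hσP : PowerSeries.map σ P = P := by
    rw [hP, map_prod]
    refine Finset.prod_congr rfl fun q hq => ?_
    rw [Finset.mem_range] at hq
    rw [map_geomSeries]
    simp only [hσ, RingHom.coe_coe, MvPolynomial.rename_X]
    rw [Equiv.swap_apply_of_ne_of_ne (by omega) (by omega)]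
  have hσH : PowerSeries.map σ (hSeries j r) = P * geomSeries y := by
    rw [hH, map_mul, hσP, map_geomSeries, hσx]
  have hcoeff : MvPolynomial.rename (Equiv.swap (j + r) (j + r + 1))
      (PowerSeries.coeff a (hSeries j r)) = PowerSeries.coeff a (P * geomSeries y) := by
    rw [← hσH, PowerSeries.coeff_map]
    rfl
  have hx : MvPolynomial.rename (Equiv.swap (j + r) (j + r + 1)) x = y := hσx
  rw [map_mul, hcoeff, hx, hH, hH', ← PowerSeries.coeff_C_mul, ← PowerSeries.coeff_C_mul,
    ← PowerSeries.coeff_C_mul, ← map_sub]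
  congr 1
  -- the partial fraction decomposition of `(x - y) / ((1 - x T) (1 - y T))`
  have h1 := one_sub_mul_geomSeries x
  have h2 := one_sub_mul_geomSeries y
  rw [map_sub]
  linear_combination (P * geomSeries x * PowerSeries.C x) * h2
    - (P * geomSeries y * PowerSeries.C y) * h1

theorem isobaricChain_X_pow (j r a : ℕ) :
    isobaricChain j r (MvPolynomial.X j ^ a) = PowerSeries.coeff a (hSeries j r) := by
  induction r with
  | zero => simp [isobaricChain, hSeries, geomSeries]
  | succ r ih => rw [isobaricChain, ih, dividedDifference_X_mul_coeff_hSeries]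

/-! ### The flagged determinant -/

/-- The polynomial obtained from `1` by the operators
`isobaricChain (b - d) m ∘ (x_{b-d} ^ (d - 1) * ·)`, …, `isobaricChain (b - 1) m`. For `d = b` it is
the Schubert polynomial of `1_m × w₀(b)`. -/
def staircasePoly (m b : ℕ) : ℕ → MvPolynomial ℕ ℤ
  | 0 => 1
  | d + 1 => isobaricChain (b - (d + 1)) m (MvPolynomial.X (b - (d + 1)) ^ d * staircasePoly m b d)

/-- The flagged Jacobi–Trudi matrix with entries `h_{d-1-2r+k}(x_j, …, x_{j+m+r})`; the factor
`T ^ (2 r)` makes the entries of negative degree vanish. -/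
def flaggedMatrix (m j d : ℕ) : Matrix (Fin d) (Fin d) (MvPolynomial ℕ ℤ) :=
  fun r k => PowerSeries.coeff (d - 1 + k) (PowerSeries.X ^ (2 * (r : ℕ)) * hSeries j (m + r))

/-- The flagged determinant in `x_{j+1}, …` equals a determinant of size one larger, with first row
the powers of `x_j` and the other rows taken from the flagged matrix in `x_j, …`. Subtracting `x_j`
times each column from the next one clears the first row and removes `x_j` from the others. -/
theorem det_bordered_eq (m j d : ℕ) :
    (Matrix.of fun r k : Fin (d + 1) => if r = 0 then (MvPolynomial.X j : MvPolynomial ℕ ℤ) ^ (k : ℕ)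
      else flaggedMatrix m j (d + 1) r k).det = (flaggedMatrix m (j + 1) d).det := by
  set x : MvPolynomial ℕ ℤ := MvPolynomial.X j with hx
  set B : Matrix (Fin (d + 1)) (Fin (d + 1)) (MvPolynomial ℕ ℤ) := Matrix.of fun r k =>
    Fin.cases (if r = 0 then 1 else flaggedMatrix m j (d + 1) r 0)
      (fun k' => Fin.cases 0 (fun r' => flaggedMatrix m (j + 1) d r' k') r) k with hB
  rw [Matrix.det_eq_of_forall_col_eq_smul_add_pred (B := B) (fun _ => x)]
  · rw [Matrix.det_succ_row_zero, Fin.sum_univ_succ]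
    have h0 : ∀ k : Fin d, B 0 k.succ = 0 := fun k => by simp [hB]
    have h1 : B 0 0 = 1 := by simp [hB]
    simp only [h0, h1]
    simp only [Fin.val_zero, pow_zero, mul_one, one_mul, mul_zero, zero_mul, Finset.sum_const_zero,
      add_zero]
    congr 1
  · intro r
    refine Fin.cases ?_ (fun r' => ?_) r
    · simp [hB]
    · simp [hB, Fin.succ_ne_zero]
  · intro r k
    refine Fin.cases ?_ (fun r' => ?_) r
    · simp [hB, pow_succ']
    · have hd : 0 < d := lt_of_le_of_lt (Nat.zero_le _) r'.2
      simp only [hB, Matrix.of_apply, Fin.succ_ne_zero, if_false, Fin.cases_succ, flaggedMatrix,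
        Fin.val_succ, Fin.val_castSucc]
      rw [← one_sub_mul_hSeries, ← PowerSeries.coeff_C_mul,
        show d + 1 - 1 + (k + 1 : ℕ) = d + k + 1 by omega, show d + 1 - 1 + (k : ℕ) = d + k by omega,
        ← PowerSeries.coeff_succ_X_mul (d + k),
        show d + (k : ℕ) + 1 = (d - 1 + k) + 2 by omega,
        ← PowerSeries.coeff_X_pow_mul _ 2 (d - 1 + k), ← map_add]
      congr 1
      rw [show m + (r' + 1 : ℕ) = m + r' + 1 by ring]
      ring

/-- The operators defining `staircasePoly` act on the first row of the bordered determinant only, as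
the other rows are symmetric in the variables involved. They turn the powers of `x_j` into complete
homogeneous polynomials. -/
theorem staircasePoly_eq_det {m b d : ℕ} (hd : d ≤ b) :
    staircasePoly m b d = (flaggedMatrix m (b - d) d).det := by
  induction d with
  | zero => simp [staircasePoly]
  | succ d ih =>
    set j := b - (d + 1) with hj
    rw [staircasePoly, ih (by omega), show b - d = j + 1 by omega, ← det_bordered_eq, ← hj,
      Matrix.det_succ_row_zero, Matrix.det_succ_row_zero, Finset.mul_sum, isobaricChain_sum]
    refine Finset.sum_congr rfl fun k _ => ?_
    set N := (flaggedMatrix m j (d + 1)).submatrix Fin.succ k.succAbove with hN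
    have hsub : (Matrix.of fun r k : Fin (d + 1) => if r = 0 then
        (MvPolynomial.X j : MvPolynomial ℕ ℤ) ^ (k : ℕ)
        else flaggedMatrix m j (d + 1) r k).submatrix Fin.succ k.succAbove = N := by
      ext r k
      simp [hN, Matrix.submatrix, Fin.succ_ne_zero]
    rw [hsub, Matrix.of_apply, if_pos rfl]
    have hsym : ∀ q < m, MvPolynomial.rename (Equiv.swap (j + q) (j + q + 1))
        ((-1 : MvPolynomial ℕ ℤ) ^ (k : ℕ) * N.det) = (-1 : MvPolynomial ℕ ℤ) ^ (k : ℕ) * N.det := by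
      intro q hq
      rw [map_mul, map_pow, map_neg, map_one, AlgHom.map_det]
      congr 2
      ext1 r l
      simp only [AlgHom.mapMatrix_apply, Matrix.map_apply, hN, Matrix.submatrix_apply, flaggedMatrix]
      exact rename_coeff_hSeries (by simp; omega) _ _
    rw [show (MvPolynomial.X j : MvPolynomial ℕ ℤ) ^ d *
        ((-1) ^ (k : ℕ) * MvPolynomial.X j ^ (k : ℕ) * N.det) =
        MvPolynomial.X j ^ (d + k) * ((-1) ^ (k : ℕ) * N.det) by ring,
      isobaricChain_mul _ hsym, isobaricChain_X_pow]
    simp only [flaggedMatrix, Fin.val_zero, mul_zero, pow_zero, one_mul, add_zero,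
      Nat.add_sub_cancel]
    ring

theorem rename_staircasePoly (m b : ℕ) {i : ℕ} (hi : i < m) :
    MvPolynomial.rename (Equiv.swap i (i + 1)) (staircasePoly m b b) = staircasePoly m b b := by
  rw [staircasePoly_eq_det le_rfl, AlgHom.map_det, Nat.sub_self]
  congr 1
  ext1 r l
  simp only [AlgHom.mapMatrix_apply, Matrix.map_apply, flaggedMatrix]
  have := rename_coeff_hSeries (j := 0) (r := m + r) (q := i) (by omega) (b - 1 + l) (2 * r)
  simpa only [zero_add] using this

theorem map_eval_hSeries (j r : ℕ) :
    PowerSeries.map (MvPolynomial.eval fun _ => (1 : ℤ)) (hSeries j r) =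
      PowerSeries.mk fun n => ((r + n).choose r : ℤ) := by
  rw [hSeries, map_prod]
  simp only [map_geomSeries, MvPolynomial.eval_X, Finset.prod_const, Finset.card_range]
  rw [← PowerSeries.invOneSubPow_val_succ_eq_mk_add_choose]
  have h1 : (1 - PowerSeries.X) * geomSeries (1 : ℤ) = 1 := by
    simpa using one_sub_mul_geomSeries (1 : ℤ)
  have h2 := (PowerSeries.invOneSubPow ℤ (r + 1)).val_inv
  rw [PowerSeries.invOneSubPow_inv_eq_one_sub_pow] at h2
  have h4 : (1 - PowerSeries.X) ^ (r + 1) * geomSeries (1 : ℤ) ^ (r + 1) = 1 := by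
    rw [← mul_pow, h1, one_pow]
  calc geomSeries (1 : ℤ) ^ (r + 1)
      = (PowerSeries.invOneSubPow ℤ (r + 1)).val * (1 - PowerSeries.X) ^ (r + 1) *
          geomSeries (1 : ℤ) ^ (r + 1) := by rw [h2, one_mul]
    _ = _ := by rw [mul_assoc, h4, mul_one]

theorem eval_staircasePoly (m b : ℕ) :
    MvPolynomial.eval (fun _ => (1 : ℤ)) (staircasePoly m b b) =
      (Matrix.of fun r k : Fin b => if 2 * (r : ℕ) ≤ b - 1 + k then
        ((m + r + (b - 1 + k - 2 * r)).choose (m + r) : ℤ) else 0).det := by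
  rw [staircasePoly_eq_det le_rfl, RingHom.map_det, Nat.sub_self]
  congr 1
  ext1 r k
  simp only [RingHom.mapMatrix_apply, Matrix.map_apply, flaggedMatrix, Matrix.of_apply,
    PowerSeries.coeff_X_pow_mul']
  split_ifs with h
  · rw [← PowerSeries.coeff_map, map_eval_hSeries, PowerSeries.coeff_mk]
  · exact map_zero _

/-! ### Evaluation of the determinant -/

/-- The polynomial `∏_{1 ≤ l ≤ k} (Y + m + l) ∏_{k < l ≤ N} (2 Y - N + l)`, which at `Y = N - r` is the
binomial coefficient `(m + N + k - r).choose (m + r)` up to a factor independent of `k`. -/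
def kratPoly (m N k : ℕ) : Polynomial ℚ :=
  (∏ l ∈ Finset.range k, (Polynomial.X + Polynomial.C (m + l + 1 : ℚ))) *
    ∏ l ∈ Finset.Ico k N, (2 * Polynomial.X + Polynomial.C (l + 1 - N : ℚ))

/-- A column operation on the family for `N + 1` gives multiples of the family for `N`. -/
theorem kratPoly_succ (m N k : ℕ) (hk : k ≤ N) :
    2 * kratPoly m (N + 1) (k + 1) = kratPoly m (N + 1) k +
      Polynomial.C (2 * m + N + k + 2 : ℚ) * kratPoly m N k := by
  have hshift : ∏ l ∈ Finset.Ico (k + 1) (N + 1),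
      (2 * Polynomial.X + Polynomial.C ((l : ℚ) + 1 - ((N + 1 : ℕ) : ℚ))) =
      ∏ l ∈ Finset.Ico k N, (2 * Polynomial.X + Polynomial.C (l + 1 - N : ℚ)) := by
    rw [← Finset.prod_Ico_add' _ k N 1]
    refine Finset.prod_congr rfl fun l _ => ?_
    push_cast
    congr 2
    ring
  simp only [kratPoly]
  rw [Finset.prod_range_succ, Finset.prod_eq_prod_Ico_succ_bot (show k < N + 1 by omega), hshift]
  have e1 : (Polynomial.C ((k : ℚ) + 1 - ((N + 1 : ℕ) : ℚ)) : Polynomial ℚ) = k - N := by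
    push_cast; simp
  have e2 : (Polynomial.C (2 * m + N + k + 2 : ℚ) : Polynomial ℚ) = 2 * m + N + k + 2 := by
    simp only [map_add, map_mul, map_natCast, map_ofNat]
  have e3 : (Polynomial.C (m + k + 1 : ℚ) : Polynomial ℚ) = m + k + 1 := by simp
  rw [e1, e2, e3]
  ring

theorem natDegree_kratPoly_le (m N k : ℕ) (hk : k ≤ N) : (kratPoly m N k).natDegree ≤ N := by
  have h1 : (∏ l ∈ Finset.range k,
      (Polynomial.X + Polynomial.C (m + l + 1 : ℚ)) : Polynomial ℚ).natDegree ≤ k := by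
    refine (Polynomial.natDegree_prod_le _ _).trans ?_
    refine (Finset.sum_le_card_nsmul _ _ 1 fun l _ => ?_).trans (by simp)
    simp only [Polynomial.natDegree_X_add_C, le_refl]
  have h2 : (∏ l ∈ Finset.Ico k N,
      (2 * Polynomial.X + Polynomial.C (l + 1 - N : ℚ)) : Polynomial ℚ).natDegree ≤ N - k := by
    refine (Polynomial.natDegree_prod_le _ _).trans ?_
    refine (Finset.sum_le_card_nsmul _ _ 1 fun l _ => ?_).trans (by simp)
    exact Polynomial.natDegree_linear_le (a := (2 : ℚ))
  refine Polynomial.natDegree_mul_le.trans ?_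
  omega

theorem coeff_kratPoly_zero (m N : ℕ) : (kratPoly m N 0).coeff N = 2 ^ N := by
  have h := Polynomial.coeff_prod_of_natDegree_le (s := Finset.range N)
    (fun l => (2 * Polynomial.X + Polynomial.C ((l : ℚ) + 1 - N) : Polynomial ℚ)) 1 (fun l _ => by
      exact Polynomial.natDegree_linear_le (a := (2 : ℚ)))
  rw [Finset.card_range, mul_one] at h
  have hp : kratPoly m N 0 = ∏ l ∈ Finset.range N,
      (2 * Polynomial.X + Polynomial.C ((l : ℚ) + 1 - N) : Polynomial ℚ) := by
    rw [kratPoly, Finset.range_zero, Finset.prod_empty, one_mul, Finset.range_eq_Ico]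
  rw [hp, h]
  have : ∀ l : ℕ, (2 * Polynomial.X + Polynomial.C ((l : ℚ) + 1 - N) : Polynomial ℚ).coeff 1 = 2 := by
    intro l
    rw [Polynomial.coeff_add, Polynomial.coeff_C_of_ne_zero one_ne_zero, add_zero,
      Polynomial.coeff_ofNat_mul, Polynomial.coeff_X_one, mul_one]
  simp only [this, Finset.prod_const, Finset.card_range]

/-- The matrix of coefficients of the polynomials `kratPoly m N k`, one polynomial in each column,
leading coefficients in the top row. -/
def kratCoeff (m N : ℕ) : Matrix (Fin (N + 1)) (Fin (N + 1)) ℚ :=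
  fun s k => (kratPoly m N k).coeff (N - s)

theorem det_kratCoeff (m N : ℕ) :
    (kratCoeff m N).det =
      ∏ l ∈ Finset.range (N + 1), ∏ i ∈ Finset.range l, (2 * m + l + i + 1 : ℚ) := by
  induction N with
  | zero => simp [kratCoeff, kratPoly]
  | succ N ih =>
    set B : Matrix (Fin (N + 2)) (Fin (N + 2)) ℚ := fun s k =>
      Fin.cases ((kratPoly m (N + 1) 0).coeff (N + 1 - s))
        (fun k' => (2 * m + N + k' + 2 : ℚ) / 2 * (kratPoly m N k').coeff (N + 1 - s)) k with hB
    rw [Matrix.det_eq_of_forall_col_eq_smul_add_pred (B := B) (fun _ => 1 / 2)]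
    · rw [Matrix.det_succ_row_zero, Fin.sum_univ_succ]
      have h1 : B 0 0 = 2 ^ (N + 1) := by
        simp only [hB, Fin.cases_zero]
        exact coeff_kratPoly_zero m (N + 1)
      have h0 : ∀ k : Fin (N + 1), B 0 k.succ = 0 := by
        intro k
        simp only [hB, Fin.cases_succ, Fin.val_zero, Nat.sub_zero]
        rw [Polynomial.coeff_eq_zero_of_natDegree_lt, mul_zero]
        exact lt_of_le_of_lt (natDegree_kratPoly_le m N k (by omega)) (by omega)
      have hsub : B.submatrix Fin.succ (Fin.succAbove 0) = Matrix.of fun s k : Fin (N + 1) =>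
          ((2 * m + N + (k : ℕ) + 2 : ℚ) / 2) * kratCoeff m N s k := by
        ext s k
        simp [hB, kratCoeff, Matrix.submatrix]
      simp only [h1, h0]
      rw [hsub, Matrix.det_mul_row, ih, Finset.prod_range_succ _ (N + 1),
        Fin.prod_univ_eq_prod_range (fun k => ((2 * m + N + k + 2 : ℚ) / 2)) (N + 1),
        Finset.prod_div_distrib, Finset.prod_const, Finset.card_range]
      have e : ∀ i : ℕ, (2 * m + ((N + 1 : ℕ) : ℚ) + i + 1 : ℚ) = 2 * m + N + i + 2 := by
        intro i; push_cast; ring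
      simp only [e]
      have h2 : (2 : ℚ) ^ (N + 1) ≠ 0 := by positivity
      simp
      field_simp
    · intro s
      simp [hB, kratCoeff]
    · intro s k
      have h := congrArg (fun p => Polynomial.coeff p (N + 1 - s)) (kratPoly_succ m N k (by omega))
      simp only [Polynomial.coeff_ofNat_mul, Polynomial.coeff_add, Polynomial.coeff_C_mul] at h
      simp only [hB, kratCoeff, Fin.cases_succ, Fin.val_succ, Fin.val_castSucc]
      linear_combination h / 2

theorem det_kratPoly_eval (m N : ℕ) :
    (Matrix.of fun r k : Fin (N + 1) => (kratPoly m N k).eval ((N : ℚ) - r)).det =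
      (∏ l ∈ Finset.range (N + 1), (l.factorial : ℚ)) *
        ∏ l ∈ Finset.range (N + 1), ∏ i ∈ Finset.range l, (2 * m + l + i + 1 : ℚ) := by
  have hmul : (Matrix.of fun r k : Fin (N + 1) => (kratPoly m N k).eval ((N : ℚ) - r)) =
      Matrix.projVandermonde (fun _ => 1) (fun r : Fin (N + 1) => (N : ℚ) - r) * kratCoeff m N := by
    ext r k
    rw [Matrix.of_apply, Matrix.mul_apply,
      Polynomial.eval_eq_sum_range' (Nat.lt_succ_of_le (natDegree_kratPoly_le m N k (by omega))),
      ← Finset.sum_range_reflect, ← Fin.sum_univ_eq_sum_range (fun j =>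
        (kratPoly m N k).coeff (N + 1 - 1 - j) * ((N : ℚ) - r) ^ (N + 1 - 1 - j))]
    refine Finset.sum_congr rfl fun s _ => ?_
    rw [Matrix.projVandermonde_apply, kratCoeff, one_pow, one_mul, mul_comm]
    congr 2
    simp [Fin.rev]
  rw [hmul, Matrix.det_mul, det_kratCoeff, Matrix.det_projVandermonde]
  congr 1
  have h := Matrix.det_vandermonde_id_eq_superFactorial (R := ℚ) N
  rw [Matrix.det_vandermonde] at h
  have h2 : ∀ n : ℕ, (n.superFactorial : ℚ) = ∏ l ∈ Finset.range (n + 1), (l.factorial : ℚ) := by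
    intro n
    induction n with
    | zero => simp
    | succ n ih => rw [Nat.superFactorial, Finset.prod_range_succ, ← ih]; push_cast; ring
  rw [← h2, ← h]
  refine Finset.prod_congr rfl fun i _ => Finset.prod_congr rfl fun j _ => ?_
  ring

/-- `∏_{1 ≤ i < j ≤ b} (2 m + i + j - 1) / (i + j - 1)`, the principal specialization of the Schubert
polynomial of `1_m × w₀(b)`. -/
def blockValue (m b : ℕ) : ℝ :=
  ∏ l ∈ Finset.range b, ∏ i ∈ Finset.range l, ((2 * m + l + i + 1) / (l + i + 1) : ℝ)

theorem prod_range_add_one_eq (l : ℕ) :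
    (∏ i ∈ Finset.range l, (l + i + 1 : ℚ)) * l.factorial = (2 * l).factorial := by
  have h := Nat.factorial_mul_ascFactorial l l
  rw [Nat.ascFactorial_eq_prod_range] at h
  rw [two_mul, ← h]
  push_cast
  rw [mul_comm]
  congr 1
  exact Finset.prod_congr rfl fun i _ => by ring

/-- The binomial entries are, up to factors depending on the row only, values of `kratPoly`. -/
theorem choose_eq_kratPoly_eval (m N r k : ℕ) (hr : r ≤ N) (hk : k ≤ N) :
    (if 2 * r ≤ N + k then ((m + r + (N + k - 2 * r)).choose (m + r) : ℚ) else 0) =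
      ((m + (N - r)).factorial : ℚ) / ((m + r).factorial * (2 * (N - r)).factorial) *
        (kratPoly m N k).eval ((N : ℚ) - r) := by
  obtain ⟨y, rfl⟩ := Nat.exists_eq_add_of_le hr
  have hy : ((r + y : ℕ) : ℚ) - r = y := by push_cast; ring
  rw [hy, Nat.add_sub_cancel_left]
  have h1 : Polynomial.eval (y : ℚ) (∏ l ∈ Finset.range k,
      (Polynomial.X + Polynomial.C (m + l + 1 : ℚ))) * (m + y).factorial = (m + y + k).factorial := by
    have h := Nat.factorial_mul_ascFactorial (m + y) k
    rw [Nat.ascFactorial_eq_prod_range] at h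
    rw [← h, Polynomial.eval_prod]
    push_cast
    rw [mul_comm]
    congr 1
    refine Finset.prod_congr rfl fun l _ => ?_
    simp only [Polynomial.eval_add, Polynomial.eval_X, Polynomial.eval_C]
    ring
  have h2 : Polynomial.eval (y : ℚ) (∏ l ∈ Finset.Ico k (r + y),
      (2 * Polynomial.X + Polynomial.C (l + 1 - (r + y : ℕ) : ℚ))) =
      if r ≤ y + k then ((2 * y).factorial : ℚ) / (y + k - r).factorial else 0 := by
    rw [Polynomial.eval_prod]
    have e : ∀ l : ℕ, Polynomial.eval (y : ℚ)
        (2 * Polynomial.X + Polynomial.C (l + 1 - (r + y : ℕ) : ℚ)) = y + l + 1 - r := by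
      intro l
      simp only [Polynomial.eval_add, Polynomial.eval_mul, Polynomial.eval_X, Polynomial.eval_C,
        Polynomial.eval_ofNat]
      push_cast
      ring
    simp only [e]
    split_ifs with h
    · obtain ⟨t, ht⟩ := Nat.exists_eq_add_of_le h
      rw [show y + k - r = t by omega, eq_div_iff (by positivity), Finset.prod_Ico_eq_prod_range]
      have h' := Nat.factorial_mul_ascFactorial t (r + y - k)
      rw [Nat.ascFactorial_eq_prod_range, show t + (r + y - k) = 2 * y by omega] at h'
      rw [← h', mul_comm]
      push_cast
      congr 1
      refine Finset.prod_congr rfl fun l _ => ?_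
      have : (y : ℚ) + k = r + t := by exact_mod_cast ht
      linear_combination this
    · refine Finset.prod_eq_zero (i := r - y - 1) ?_ ?_
      · rw [Finset.mem_Ico]; omega
      · rw [show r - y - 1 = r - (y + 1) by omega, Nat.cast_sub (by omega)]
        push_cast
        ring
  rw [kratPoly, Polynomial.eval_mul, h2]
  have hiff : 2 * r ≤ r + y + k ↔ r ≤ y + k := by omega
  simp only [hiff]
  split_ifs with h
  · obtain ⟨t, ht⟩ := Nat.exists_eq_add_of_le h
    rw [show r + y + k - 2 * r = t by omega, show y + k - r = t by omega, Nat.choose_symm_add,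
      Nat.add_choose,
      Nat.cast_div (Nat.factorial_mul_factorial_dvd_factorial_add _ _) (by positivity),
      show m + r + t = m + y + k by omega, ← h1]
    push_cast
    field_simp
  · rw [mul_zero, mul_zero]

theorem eval_staircasePoly_eq_blockValue (m b : ℕ) :
    ((MvPolynomial.eval (fun _ => (1 : ℤ)) (staircasePoly m b b) : ℤ) : ℝ) = blockValue m b := by
  rcases Nat.eq_zero_or_pos b with rfl | hb
  · simp [staircasePoly, blockValue]
  obtain ⟨N, rfl⟩ := Nat.exists_eq_add_of_le' hb
  have hq : ((MvPolynomial.eval (fun _ => (1 : ℤ)) (staircasePoly m (N + 1) (N + 1)) : ℤ) : ℚ) =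
      ∏ l ∈ Finset.range (N + 1), ∏ i ∈ Finset.range l, ((2 * m + l + i + 1) / (l + i + 1) : ℚ) := by
    rw [eval_staircasePoly]
    have hcast := Int.cast_det (R := ℚ) (Matrix.of fun r k : Fin (N + 1) =>
      if 2 * (r : ℕ) ≤ N + 1 - 1 + k then
        ((m + r + (N + 1 - 1 + k - 2 * r)).choose (m + r) : ℤ) else 0)
    rw [hcast]
    have hM : (Matrix.of fun r k : Fin (N + 1) =>
      if 2 * (r : ℕ) ≤ N + 1 - 1 + k then
        ((m + r + (N + 1 - 1 + k - 2 * r)).choose (m + r) : ℤ) else 0).map (fun x : ℤ => (x : ℚ)) =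
        Matrix.of fun r k : Fin (N + 1) =>
          (((m + (N - r)).factorial : ℚ) / ((m + r).factorial * (2 * (N - r)).factorial)) *
          (Matrix.of fun r k : Fin (N + 1) => (kratPoly m N k).eval ((N : ℚ) - r)) r k := by
      ext r k
      rw [Matrix.map_apply, Matrix.of_apply, Matrix.of_apply, Matrix.of_apply,
        ← choose_eq_kratPoly_eval m N r k (by omega) (by omega), Nat.add_sub_cancel]
      split_ifs <;> simp
    rw [hM, Matrix.det_mul_column, det_kratPoly_eval,
      Fin.prod_univ_eq_prod_range (fun r => (((m + (N - r)).factorial : ℚ) /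
        ((m + r).factorial * (2 * (N - r)).factorial))) (N + 1)]
    rw [Finset.prod_div_distrib, Finset.prod_mul_distrib]
    have e1 : ∏ r ∈ Finset.range (N + 1), ((m + (N - r)).factorial : ℚ) =
        ∏ r ∈ Finset.range (N + 1), ((m + r).factorial : ℚ) :=
      Finset.prod_range_reflect (fun r => ((m + r).factorial : ℚ)) (N + 1)
    have e2 : ∏ r ∈ Finset.range (N + 1), ((2 * (N - r)).factorial : ℚ) =
        ∏ r ∈ Finset.range (N + 1), ((2 * r).factorial : ℚ) :=
      Finset.prod_range_reflect (fun r => ((2 * r).factorial : ℚ)) (N + 1)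
    have e3 : ∏ r ∈ Finset.range (N + 1), ((m + r).factorial : ℚ) ≠ 0 :=
      Finset.prod_ne_zero_iff.mpr fun r _ => by positivity
    rw [e1, e2]
    simp only [← prod_range_add_one_eq, Finset.prod_div_distrib, Finset.prod_mul_distrib]
    have e4 : ∏ r ∈ Finset.range (N + 1), (r.factorial : ℚ) ≠ 0 :=
      Finset.prod_ne_zero_iff.mpr fun r _ => by positivity
    have e5 : ∏ l ∈ Finset.range (N + 1), ∏ i ∈ Finset.range l, (l + i + 1 : ℚ) ≠ 0 :=
      Finset.prod_ne_zero_iff.mpr fun l _ => Finset.prod_ne_zero_iff.mpr fun i _ => by positivity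
    field_simp
  have h := congrArg (fun x : ℚ => (x : ℝ)) hq
  rw [blockValue]
  push_cast at h
  exact h

/-! ### Schubert polynomials of layered permutations -/

theorem schubert_of_first_ascent {n : ℕ} {w : Equiv.Perm (Fin n)} {i : ℕ} (h : IsAscent w i)
    (hmin : ∀ j < i, ¬ IsAscent w j) :
    schubert w = dividedDifference i (schubert (w * simpleSwap i h.choose)) := by
  classical
  have hex : ∃ i, IsAscent w i := ⟨i, h⟩
  have key : ∀ k (_ : k = i) (hk' : k + 1 < n),
      dividedDifference k (schubert (w * simpleSwap k hk')) =
        dividedDifference i (schubert (w * simpleSwap i h.choose)) := by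
    rintro _ rfl _; rfl
  rw [schubert, dif_pos hex]
  exact key _ ((Nat.find_eq_iff _).2 ⟨h, hmin⟩) _

theorem schubert_of_no_ascent {n : ℕ} {w : Equiv.Perm (Fin n)} (h : ∀ i, ¬ IsAscent w i) :
    schubert w = ∏ i ∈ Finset.range n, MvPolynomial.X i ^ (n - 1 - i) := by
  rw [schubert, dif_neg (by simpa using h)]

theorem mul_simpleSwap_val {n : ℕ} (w : Equiv.Perm (Fin n)) (i : ℕ) (h : i + 1 < n) (p : ℕ)
    (hp : p < n) : ((w * simpleSwap i h) ⟨p, hp⟩ : ℕ) =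
      if p = i then (w ⟨i + 1, h⟩ : ℕ) else if p = i + 1 then (w ⟨i, Nat.lt_of_succ_lt h⟩ : ℕ)
        else (w ⟨p, hp⟩ : ℕ) := by
  rw [Equiv.Perm.mul_apply, simpleSwap, Equiv.swap_apply_def]
  simp only [Fin.mk.injEq]
  split_ifs <;> rfl

/-- The monomial `∏_{p < N} x_p ^ e(p)`. -/
def monomialProd (N : ℕ) (e : ℕ → ℕ) : MvPolynomial ℕ ℤ :=
  ∏ p ∈ Finset.range N, MvPolynomial.X p ^ e p

theorem monomialProd_eq_mul {N i c : ℕ} {e e' : ℕ → ℕ} (hi : i < N) (h : e' i = c + e i)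
    (h' : ∀ p < N, p ≠ i → e' p = e p) :
    monomialProd N e' = MvPolynomial.X i ^ c * monomialProd N e := by
  have hi' := Finset.mem_range.mpr hi
  rw [monomialProd, monomialProd, ← Finset.mul_prod_erase _ _ hi', ← Finset.mul_prod_erase _ _ hi', h,
    pow_add, mul_assoc]
  congr 2
  refine Finset.prod_congr rfl fun p hp => ?_
  rw [Finset.mem_erase, Finset.mem_range] at hp
  rw [h' p hp.2 hp.1]

theorem rename_monomialProd {N i : ℕ} {e : ℕ → ℕ} (hi : i + 1 < N) (h : e i = e (i + 1)) :
    MvPolynomial.rename (Equiv.swap i (i + 1)) (monomialProd N e) = monomialProd N e := by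
  rw [monomialProd, map_prod]
  simp only [map_pow, MvPolynomial.rename_X]
  have hmem : ∀ p ∈ Finset.range N, Equiv.swap i (i + 1) p ∈ Finset.range N := by
    intro p hp
    rw [Finset.mem_range] at hp ⊢
    rw [Equiv.swap_apply_def]
    split_ifs <;> omega
  refine Finset.prod_bij (fun p _ => Equiv.swap i (i + 1) p) hmem
    (fun p _ p' _ h => (Equiv.swap i (i + 1)).injective h)
    (fun p hp => ⟨Equiv.swap i (i + 1) p, hmem p hp, Equiv.swap_apply_self _ _ _⟩) ?_
  intro p _
  congr 1
  rw [Equiv.swap_apply_def]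
  split_ifs with h1 h2
  · rw [h1, h]
  · rw [h2, h]
  · rfl

/-- The one-line notation
`n-1, …, n-j, m-1, …, t, n-1-j, t-1, …, 0, n-2-j, …, m` (where `n = m + b`), met while `w₀(m) × w₀(b)`
is sorted into the longest permutation: `j` letters of the second block have arrived at the front
and the next one has passed `t` letters of the first block. -/
def sortWord (m b j t p : ℕ) : ℕ :=
  if p < j then m + b - 1 - p
  else if p < j + m - t then m - 1 - (p - j)
  else if p = j + m - t then m + b - 1 - j
  else if p ≤ j + m then j + m - p
  else m + b - 1 - (p - m)

theorem isAscent_iff_of_val {n : ℕ} {w : Equiv.Perm (Fin n)} {g : ℕ → ℕ}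
    (hw : ∀ p (hp : p < n), (w ⟨p, hp⟩ : ℕ) = g p) (i : ℕ) :
    IsAscent w i ↔ i + 1 < n ∧ g i < g (i + 1) := by
  constructor
  · rintro ⟨h, hlt⟩
    refine ⟨h, ?_⟩
    rw [← hw i (by omega), ← hw (i + 1) h]
    exact hlt
  · rintro ⟨h, hlt⟩
    refine ⟨h, ?_⟩
    rw [← hw i (by omega), ← hw (i + 1) h] at hlt
    exact hlt

theorem schubert_of_sortWord_step {m b j t : ℕ} (hj : j < b) (ht : t < m)
    {w : Equiv.Perm (Fin (m + b))} (hw : ∀ p (hp : p < m + b), (w ⟨p, hp⟩ : ℕ) = sortWord m b j t p) :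
    ∃ w' : Equiv.Perm (Fin (m + b)),
      (∀ p (hp : p < m + b), (w' ⟨p, hp⟩ : ℕ) = sortWord m b j (t + 1) p) ∧
      schubert w = dividedDifference (j + (m - (t + 1))) (schubert w') := by
  have hasc : IsAscent w (j + (m - (t + 1))) := by
    rw [isAscent_iff_of_val hw]
    refine ⟨by omega, ?_⟩
    simp only [sortWord]
    split_ifs <;> omega
  have hmin : ∀ i < j + (m - (t + 1)), ¬ IsAscent w i := by
    intro i hi
    rw [isAscent_iff_of_val hw]
    simp only [sortWord, not_and]
    intro _
    split_ifs <;> omega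
  refine ⟨_, ?_, schubert_of_first_ascent hasc hmin⟩
  intro p hp
  rw [mul_simpleSwap_val, hw, hw, hw]
  simp only [sortWord]
  split_ifs <;> omega

/-- The Schubert polynomial is a monomial times `staircasePoly`. Each step `∂_i` of the sorting acts on
a product of `x_i`, a monomial symmetric in `x_i, x_{i+1}`, and a further factor, and so becomes the
isobaric operator `∂_i x_i` on that factor. -/
theorem schubert_of_sortWord {m b d : ℕ} (hd : d ≤ b) {w : Equiv.Perm (Fin (m + b))}
    (hw : ∀ p (hp : p < m + b), (w ⟨p, hp⟩ : ℕ) = sortWord m b (b - d) 0 p) :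
    schubert w = monomialProd (b - d + m)
      (fun p => if p < b - d then m + b - 1 - p else m - 1 - (p - (b - d))) *
        staircasePoly m b d := by
  induction d generalizing w with
  | zero =>
    rw [schubert_of_no_ascent, staircasePoly, mul_one, monomialProd]
    · rw [show b - 0 + m = m + b by omega]
      refine Finset.prod_congr rfl fun p hp => ?_
      rw [Finset.mem_range] at hp
      congr 1
      split_ifs <;> omega
    · intro i
      rw [isAscent_iff_of_val hw]
      simp only [sortWord, not_and]
      intro _
      split_ifs <;> omega
  | succ d ih =>
    set j := b - (d + 1) with hj
    have key : ∀ r ≤ m, ∀ w : Equiv.Perm (Fin (m + b)),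
        (∀ p (hp : p < m + b), (w ⟨p, hp⟩ : ℕ) = sortWord m b j (m - r) p) →
        schubert w = monomialProd (j + m + 1)
          (fun p => if p < j then m + b - 1 - p else m - (p - j) - if p < j + r then 1 else 0) *
            isobaricChain j r (MvPolynomial.X j ^ d * staircasePoly m b d) := by
      intro r
      induction r with
      | zero =>
        intro _ w hw
        have hw' : ∀ p (hp : p < m + b), (w ⟨p, hp⟩ : ℕ) = sortWord m b (b - d) 0 p := by
          intro p hp
          rw [hw, show b - d = j + 1 by omega]
          simp only [sortWord]
          split_ifs <;> omega
        rw [ih (by omega) hw', isobaricChain, show b - d + m = j + m + 1 by omega,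
          monomialProd_eq_mul (i := j) (c := d) (e := fun p => if p < j then m + b - 1 - p else
            m - (p - j) - if p < j + 0 then 1 else 0) (by omega)]
        · ring
        · split_ifs <;> omega
        · intro p hp hpj
          split_ifs <;> omega
      | succ r ihr =>
        intro hr w hw
        obtain ⟨w', hw', hS⟩ := schubert_of_sortWord_step (by omega) (by omega) hw
        rw [show m - (r + 1) + 1 = m - r by omega] at hw'
        rw [hS, ihr (by omega) w' hw', isobaricChain, show m - (m - (r + 1) + 1) = r by omega,
          monomialProd_eq_mul (i := j + r) (c := 1) (e := fun p => if p < j then m + b - 1 - p else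
            m - (p - j) - if p < j + (r + 1) then 1 else 0) (by omega), pow_one,
          mul_right_comm, dividedDifference_mul, mul_comm]
        · refine rename_monomialProd (by omega) ?_
          split_ifs <;> omega
        · split_ifs <;> omega
        · intro p hp hpj
          split_ifs <;> omega
    rw [key m le_rfl w (by rwa [Nat.sub_self]), staircasePoly, ← hj]
    congr 1
    rw [monomialProd, Finset.prod_range_succ, monomialProd]
    have : (if j + m < j then m + b - 1 - (j + m) else m - (j + m - j) -
        if j + m < j + m then 1 else 0) = 0 := by
      split_ifs <;> omega
    rw [this, pow_zero, mul_one]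
    refine Finset.prod_congr rfl fun p hp => ?_
    rw [Finset.mem_range] at hp
    congr 1
    split_ifs <;> omega

theorem val_of_no_ascent {m : ℕ} {u : Equiv.Perm (Fin m)} (h : ∀ i, ¬ IsAscent u i) (p : ℕ)
    (hp : p < m) : (u ⟨p, hp⟩ : ℕ) = m - 1 - p := by
  have hdesc : ∀ i (hi : i + 1 < m), (u ⟨i + 1, hi⟩ : ℕ) < u ⟨i, by omega⟩ := by
    intro i hi
    have h1 : ¬ u ⟨i, by omega⟩ < u ⟨i + 1, hi⟩ := fun hlt => h i ⟨hi, hlt⟩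
    have h2 : u ⟨i, by omega⟩ ≠ u ⟨i + 1, hi⟩ := fun he => by
      have := u.injective he
      simp at this
    exact Fin.lt_def.mp (lt_of_le_of_ne (not_lt.mp h1) h2.symm)
  have hup : ∀ p (hp : p < m), (u ⟨p, hp⟩ : ℕ) + p ≤ m - 1 := by
    intro p
    induction p with
    | zero => intro hp; have := (u ⟨0, hp⟩).2; omega
    | succ p ih => intro hp; have := hdesc p hp; have := ih (by omega); omega
  have hlow : ∀ k p (hp : p < m), p + k = m - 1 → k ≤ (u ⟨p, hp⟩ : ℕ) := by
    intro k
    induction k with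
    | zero => intro p hp _; exact Nat.zero_le _
    | succ k ih =>
      intro p hp hk
      have := hdesc p (by omega)
      have := ih (p + 1) (by omega) (by omega)
      omega
  have := hup p hp
  have := hlow (m - 1 - p) p hp (by omega)
  omega

/-- Appending a reversed block multiplies the Schubert polynomial by `staircasePoly`. -/
theorem schubert_append_block {m b : ℕ} (u : Equiv.Perm (Fin m)) (w : Equiv.Perm (Fin (m + b)))
    (h1 : ∀ p (hp : p < m), (w ⟨p, by omega⟩ : ℕ) = u ⟨p, hp⟩)
    (h2 : ∀ q (hq : q < b), (w ⟨m + q, by omega⟩ : ℕ) = m + (b - 1 - q)) :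
    schubert w = schubert u * staircasePoly m b b := by
  classical
  induction hN : ∑ j : Fin m, (j : ℕ) * (u j : ℕ) using Nat.strong_induction_on
    generalizing u w with
  | _ N ih =>
    subst hN
    by_cases h : ∃ i, IsAscent u i
    · obtain ⟨hi, hasc⟩ := Nat.find_spec h
      set i := Nat.find h with hi_def
      have hmin : ∀ j < i, ¬ IsAscent u j := fun j hj => Nat.find_min h hj
      have hiff : ∀ j, j + 1 < m → (IsAscent w j ↔ IsAscent u j) := by
        intro j hj
        constructor
        · rintro ⟨_, hlt⟩
          exact ⟨hj, by rw [Fin.lt_def, ← h1, ← h1]; exact hlt⟩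
        · rintro ⟨_, hlt⟩
          exact ⟨by omega, by rw [Fin.lt_def, h1 j (by omega), h1 (j + 1) hj]; exact hlt⟩
      rw [schubert_of_first_ascent (Nat.find_spec h) hmin,
        schubert_of_first_ascent ((hiff i hi).2 (Nat.find_spec h))
          (fun j hj hw => hmin j hj ((hiff j (by omega)).1 hw)),
        ih _ (sum_mul_simpleSwap_lt u i hi hasc) (u * simpleSwap i hi) _ ?_ ?_ rfl,
        dividedDifference_mul]
      · exact rename_staircasePoly m b (by omega)
      · intro p hp
        rw [mul_simpleSwap_val, mul_simpleSwap_val, h1 _ hi, h1 i (by omega), h1 p hp]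
      · intro q hq
        rw [mul_simpleSwap_val, if_neg (by omega), if_neg (by omega), h2 q hq]
    · have h' : ∀ i, ¬ IsAscent u i := by simpa using h
      rw [schubert_of_no_ascent h', schubert_of_sortWord le_rfl]
      · congr 1
        rw [monomialProd]
        simp
      · intro p hp
        rw [Nat.sub_self]
        rcases lt_or_ge p m with hpm | hpm
        · rw [h1 p hpm, val_of_no_ascent h' p hpm]
          simp only [sortWord]
          split_ifs <;> omega
        · obtain ⟨q, rfl⟩ := Nat.exists_eq_add_of_le hpm
          rw [h2 q (by omega)]
          simp only [sortWord]
          split_ifs <;> omega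

/-- `Υ` of the layered permutation `w(…, b₂, b₁)`, as a function of the list `b₁, b₂, …`. -/
def listValue : List ℕ → ℝ
  | [] => 1
  | b :: L => blockValue L.sum b * listValue L

theorem layeredPerm_val {n : ℕ} (c : Composition n) (i : ℕ) (hi : i < c.blocks.length) (k : ℕ)
    (hk : k < c.blocks[i]) (p : ℕ) (hp : p < n) (hpk : p = (c.blocks.take i).sum + k) :
    (layeredPerm c ⟨p, hp⟩ : ℕ) = (c.blocks.take i).sum + (c.blocks[i] - 1 - k) := by
  have h1 : (⟨p, hp⟩ : Fin n) = c.blocksFinEquiv ⟨⟨i, hi⟩, ⟨k, hk⟩⟩ := by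
    ext
    exact hpk
  rw [layeredPerm, h1, Equiv.trans_apply, Equiv.trans_apply, Equiv.symm_apply_apply]
  change (c.blocks.take i).sum + (c.blocks[i] - (k + 1)) = _
  omega

/-- `listValue` computes `Υ`; the list is reversed because the last block is split off first. -/
theorem upsilon_layeredPerm {n : ℕ} (c : Composition n) :
    (upsilon (layeredPerm c) : ℝ) = listValue c.blocks.reverse := by
  obtain ⟨L, hL⟩ : ∃ L, c.blocks.reverse = L := ⟨_, rfl⟩
  induction L generalizing n with
  | nil =>
    have hb : c.blocks = [] := by simpa using hL
    have hn : n = 0 := by rw [← c.blocks_sum, hb]; rfl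
    subst hn
    rw [hL, upsilon, schubert_of_no_ascent]
    · simp [listValue]
    · rintro i ⟨h, _⟩
      omega
  | cons b L ih =>
    have hb : c.blocks = L.reverse ++ [b] := by
      rw [← List.reverse_reverse c.blocks, hL, List.reverse_cons]
    have hn : n = L.sum + b := by rw [← c.blocks_sum, hb]; simp
    set m := L.sum with hm
    subst hn
    have hpos : ∀ {i}, i ∈ L.reverse → 0 < i := fun {i} hi =>
      c.blocks_pos (by rw [hb]; exact List.mem_append_left _ hi)
    have hsum : L.reverse.sum = m := by rw [List.sum_reverse]
    let c' : Composition m := ⟨L.reverse, hpos, hsum⟩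
    have hS : schubert (layeredPerm c) = schubert (layeredPerm c') * staircasePoly m b b := by
      apply schubert_append_block
      · intro p hp
        set i : ℕ := (c'.index ⟨p, hp⟩ : ℕ) with hi
        have hil : i < L.reverse.length := (c'.index ⟨p, hp⟩).2
        have hle : (L.reverse.take i).sum ≤ p := c'.sizeUpTo_index_le ⟨p, hp⟩
        have hlt : p < (L.reverse.take (i + 1)).sum := c'.lt_sizeUpTo_index_succ ⟨p, hp⟩
        rw [List.sum_take_succ _ _ hil] at hlt
        obtain ⟨k, hk⟩ := Nat.exists_eq_add_of_le hle
        have hkl : k < L.reverse[i] := by omega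
        have hget : c.blocks[i]'(by rw [hb, List.length_append]; omega) = L.reverse[i] := by
          simp only [hb]
          exact List.getElem_append_left hil
        have htake : c.blocks.take i = L.reverse.take i := by
          rw [hb, List.take_append_of_le_length hil.le]
        rw [layeredPerm_val c i (by rw [hb, List.length_append]; omega) k (by rw [hget]; exact hkl)
          p _ (by rw [htake]; exact hk), layeredPerm_val c' i hil k hkl p hp hk, hget, htake]
      · intro q hq
        have hlen : L.reverse.length < c.blocks.length := by rw [hb, List.length_append]; simp
        have hget : c.blocks[L.reverse.length] = b := by
          simp only [hb]
          exact List.getElem_concat_length rfl _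
        have htake : (c.blocks.take L.reverse.length).sum = m := by
          rw [hb, List.take_left, hsum]
        rw [layeredPerm_val c L.reverse.length hlen q (by rw [hget]; exact hq) _ _
          (by rw [htake]), hget, htake]
    have hc' := ih c' (List.reverse_reverse L)
    rw [show c'.blocks.reverse = L from List.reverse_reverse L] at hc'
    rw [hL, listValue, upsilon, hS, map_mul, Int.cast_mul, eval_staircasePoly_eq_blockValue, ← hc',
      mul_comm]
    rfl

/-! ### Comparison of the products with their integral approximation -/

/-- `t² log t`, a second antiderivative of `2 log t + 3`. -/
def sqLog (t : ℝ) : ℝ := t ^ 2 * Real.log t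

theorem continuous_sqLog : Continuous sqLog := by
  have h : sqLog = fun t => t * (t * Real.log t) := by
    funext t; simp only [sqLog]; ring
  rw [h]
  exact continuous_id.mul Real.continuous_mul_log

theorem hasDerivAt_sqLog {t : ℝ} (ht : t ≠ 0) :
    HasDerivAt sqLog (2 * (t * Real.log t) + t) t := by
  have h := (hasDerivAt_pow 2 t).mul (Real.hasDerivAt_log ht)
  refine h.congr_deriv ?_
  push_cast
  field_simp

theorem sqLog_mul {c x : ℝ} (hc : 0 < c) :
    sqLog (c * x) = c ^ 2 * sqLog x + c ^ 2 * x ^ 2 * Real.log c := by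
  rcases eq_or_ne x 0 with rfl | hx
  · simp [sqLog]
  · rw [sqLog, sqLog, Real.log_mul hc.ne' hx]
    ring

theorem f_eq_sqLog (x : ℝ) : f x =
    sqLog x - 1 / 2 * sqLog (1 - x) - 1 / 2 * sqLog (1 + x) + 2 * x * Real.log 2 := by
  simp only [f, sqLog]
  ring

/-- A second antiderivative (in `t`) of `log ((M + t) / t)`. -/
def phiInt (M t : ℝ) : ℝ := (sqLog (M + t) - sqLog t) / 2

/-- The integral `∫₀ᵇ ∫₀ʸ log ((2 m + x + y) / (x + y)) dx dy` that approximates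
`log (blockValue m b)`. -/
def blockIntegral (m b : ℝ) : ℝ :=
  (phiInt (2 * m) (2 * b) - 2 * phiInt (2 * m) b + phiInt (2 * m) 0) / 2

theorem blockIntegral_eq (m b : ℝ) (hn : 0 < m + b) :
    blockIntegral m b = (m + b) ^ 2 * f (m / (m + b)) := by
  obtain ⟨n, hn'⟩ : ∃ n, n = m + b := ⟨_, rfl⟩
  rw [← hn'] at hn ⊢
  obtain ⟨x, hx⟩ : ∃ x, m / n = x := ⟨_, rfl⟩
  have hm : m = n * x := by rw [← hx]; field_simp
  have hb : b = n * (1 - x) := by linear_combination -hn' - hm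
  have e1 := sqLog_mul (c := n) (x := x) hn
  have e2 := sqLog_mul (c := n) (x := 1 - x) hn
  have e3 := sqLog_mul (c := n) (x := 1 + x) hn
  have d1 := sqLog_mul (c := 2) (x := n * x) two_pos
  have d2 := sqLog_mul (c := 2) (x := n * (1 - x)) two_pos
  have d3 := sqLog_mul (c := 2) (x := n) two_pos
  have hn2 : sqLog n = n ^ 2 * Real.log n := rfl
  have hz : sqLog 0 = 0 := by simp [sqLog]
  rw [hx]
  simp only [blockIntegral, phiInt, f_eq_sqLog, add_zero, hm, hb, hz]
  rw [show 2 * (n * x) + 2 * (n * (1 - x)) = 2 * n by ring,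
    show 2 * (n * x) + n * (1 - x) = n * (1 + x) by ring]
  linear_combination d1 / 4 + d3 / 4 - d2 / 4 - e2 / 2 - e3 / 2 + e1 + hn2

theorem two_mul_le_log_sub_log {t h : ℝ} (hh : 0 ≤ h) (ht : h < t) :
    2 * h / t ≤ Real.log (t + h) - Real.log (t - h) := by
  have ht0 : 0 < t := hh.trans_lt ht
  have h1 := Real.sum_range_le_log_div (x := h / t) (by positivity) ((div_lt_one ht0).2 ht) 1
  have e : (1 + h / t) / (1 - h / t) = (t + h) / (t - h) := by
    have : t - h ≠ 0 := by linarith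
    field_simp
  rw [e, Real.log_div (by linarith) (by linarith)] at h1
  simp at h1
  rw [mul_div_assoc]
  linarith

theorem inv_le_second_difference {t : ℝ} (ht : 1 < t) :
    1 / t ≤ (t + 1) * Real.log (t + 1) - 2 * (t * Real.log t) + (t - 1) * Real.log (t - 1) := by
  set q : ℝ → ℝ := fun h => (t + h) * Real.log (t + h) + (t - h) * Real.log (t - h) - h ^ 2 / t
    with hq
  have hd : ∀ h ∈ Set.Icc (0 : ℝ) 1,
      HasDerivAt q (Real.log (t + h) - Real.log (t - h) - 2 * h / t) h := by
    intro h hh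
    have h1 : t + h ≠ 0 := by linarith [hh.1]
    have h2 : t - h ≠ 0 := by linarith [hh.2]
    have d1 := (Real.hasDerivAt_mul_log h1).comp h ((hasDerivAt_id h).const_add t)
    have d2 := (Real.hasDerivAt_mul_log h2).comp h ((hasDerivAt_id h).const_sub t)
    have d3 := (hasDerivAt_pow 2 h).div_const t
    refine ((d1.add d2).sub d3).congr_deriv ?_
    push_cast
    ring
  have hmono : MonotoneOn q (Set.Icc 0 1) := by
    refine monotoneOn_of_deriv_nonneg (convex_Icc 0 1)
      (fun h hh => (hd h hh).continuousAt.continuousWithinAt)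
      (fun h hh => (hd h (interior_subset hh)).differentiableAt.differentiableWithinAt) ?_
    intro h hh
    rw [interior_Icc] at hh
    rw [(hd h (Set.Ioo_subset_Icc_self hh)).deriv]
    linarith [two_mul_le_log_sub_log hh.1.le (hh.2.trans ht)]
  have := hmono (Set.left_mem_Icc.2 zero_le_one) (Set.right_mem_Icc.2 zero_le_one) zero_le_one
  simp only [hq, add_zero, sub_zero, one_pow] at this
  norm_num at this ⊢
  linarith

/-- Half the second difference of `t² log t` at `t`, minus `log t`, increases, since `1 / t` is
convex. -/
theorem monotoneOn_second_difference_sub_log :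
    MonotoneOn (fun t => (sqLog (t + 1) - 2 * sqLog t + sqLog (t - 1)) / 2 - Real.log t)
      (Set.Ici 1) := by
  have hd : ∀ t ∈ Set.Ioi (1 : ℝ),
      HasDerivAt (fun t => (sqLog (t + 1) - 2 * sqLog t + sqLog (t - 1)) / 2 - Real.log t)
        ((t + 1) * Real.log (t + 1) - 2 * (t * Real.log t) + (t - 1) * Real.log (t - 1) - 1 / t)
        t := by
    intro t ht
    have ht' : (1 : ℝ) < t := ht
    have d1 := (hasDerivAt_sqLog (t := t + 1) (by linarith)).comp t ((hasDerivAt_id t).add_const 1)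
    have d2 := (hasDerivAt_sqLog (t := t) (by linarith)).const_mul 2
    have d3 := (hasDerivAt_sqLog (t := t - 1) (by linarith)).comp t ((hasDerivAt_id t).sub_const 1)
    have d4 := Real.hasDerivAt_log (x := t) (by linarith)
    refine ((((d1.sub d2).add d3).div_const 2).sub d4).congr_deriv ?_
    ring
  refine monotoneOn_of_deriv_nonneg (convex_Ici 1) ?_ ?_ ?_
  · refine ContinuousOn.sub (Continuous.continuousOn ?_) (Real.continuousOn_log.mono ?_)
    · have := continuous_sqLog
      fun_prop
    · intro t ht
      have : (1 : ℝ) ≤ t := ht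
      simp only [Set.mem_compl_iff, Set.mem_singleton_iff]
      linarith
  · rw [interior_Ici]
    exact fun t ht => (hd t ht).differentiableAt.differentiableWithinAt
  · rw [interior_Ici]
    intro t ht
    rw [(hd t ht).deriv]
    linarith [inv_le_second_difference ht]

/-- Jensen's inequality for the convex function `log ((M + t) / t)`: the second difference is the
integral of `log ((M + x + y) / (x + y))` over a unit square centred on the line `x + y = s`. -/
theorem log_sub_log_le_second_difference {M s : ℝ} (hM : 0 ≤ M) (hs : 1 ≤ s) :
    Real.log (M + s) - Real.log s ≤ phiInt M (s + 1) - 2 * phiInt M s + phiInt M (s - 1) := by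
  have h := monotoneOn_second_difference_sub_log (Set.mem_Ici.2 hs)
    (Set.mem_Ici.2 (by linarith : (1 : ℝ) ≤ M + s)) (by linarith : s ≤ M + s)
  simp only [phiInt, ← add_assoc, ← add_sub_assoc] at h ⊢
  linarith

theorem log_add_one_sub_log_bounds {t : ℝ} (ht : 0 < t) :
    2 / (2 * t + 1) ≤ Real.log (t + 1) - Real.log t ∧
      Real.log (t + 1) - Real.log t ≤ (2 * t + 1) / (2 * t * (t + 1)) := by
  have hx0 : 0 ≤ 1 / (2 * t + 1) := by positivity
  have hx1 : 1 / (2 * t + 1) < 1 := by rw [div_lt_one (by linarith)]; linarith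
  have h1 := Real.sum_range_le_log_div hx0 hx1 1
  have h2 := Real.log_div_le_sum_range_add hx0 hx1 0
  have e : (1 + 1 / (2 * t + 1)) / (1 - 1 / (2 * t + 1)) = (t + 1) / t := by
    have : 2 * t + 1 - 1 ≠ 0 := by linarith
    have : 2 * t + 1 ≠ 0 := by linarith
    field_simp
    ring
  rw [e, Real.log_div (by linarith) (by linarith)] at h1 h2
  constructor
  · simp at h1
    rw [div_eq_mul_inv]
    linarith
  · have e2 : (1 / (2 * t + 1)) ^ (2 * 0 + 1) / (1 - (1 / (2 * t + 1)) ^ 2) =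
        (2 * t + 1) / (2 * t * (t + 1)) / 2 := by
      have h3 : (2 * t + 1) ^ 2 - 1 ≠ 0 := by nlinarith
      have : 2 * t + 1 ≠ 0 := by linarith
      rw [mul_zero, zero_add, pow_one, div_pow, one_pow, one_sub_div (by positivity)]
      field_simp
      ring
    rw [e2] at h2
    simp at h2
    linarith

theorem second_difference_le_inv {t : ℝ} (ht : 0 < t) :
    (t + 2) * Real.log (t + 2) - 2 * ((t + 1) * Real.log (t + 1)) + t * Real.log t ≤ 1 / t := by
  have h1 := (log_add_one_sub_log_bounds ht).1
  have h2 := (log_add_one_sub_log_bounds (t := t + 1) (by linarith)).2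
  rw [show t + 1 + 1 = t + 2 by ring] at h2
  have h3 := mul_le_mul_of_nonneg_left h1 ht.le
  have h4 := mul_le_mul_of_nonneg_left h2 (by linarith : 0 ≤ t + 2)
  have h5 : (t + 2) * ((2 * (t + 1) + 1) / (2 * (t + 1) * (t + 2))) - t * (2 / (2 * t + 1)) ≤
      1 / t := by
    have e : (t + 2) * ((2 * (t + 1) + 1) / (2 * (t + 1) * (t + 2))) - t * (2 / (2 * t + 1)) =
        (4 * t + 3) / ((2 * t + 1) * (2 * t + 2)) := by
      field_simp
      ring
    rw [e, div_le_div_iff₀ (by positivity) ht]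
    nlinarith
  linarith

/-- Half the second difference of `t² log t` at `t + 1`, minus `log t`, decreases, since `1 / t`
decreases. -/
theorem antitoneOn_second_difference_sub_log :
    AntitoneOn (fun t => (sqLog (t + 2) - 2 * sqLog (t + 1) + sqLog t) / 2 - Real.log t)
      (Set.Ioi 0) := by
  have hd : ∀ t ∈ Set.Ioi (0 : ℝ),
      HasDerivAt (fun t => (sqLog (t + 2) - 2 * sqLog (t + 1) + sqLog t) / 2 - Real.log t)
        ((t + 2) * Real.log (t + 2) - 2 * ((t + 1) * Real.log (t + 1)) + t * Real.log t - 1 / t)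
        t := by
    intro t ht
    have ht' : (0 : ℝ) < t := ht
    have d1 := (hasDerivAt_sqLog (t := t + 2) (by linarith)).comp t ((hasDerivAt_id t).add_const 2)
    have d2 := ((hasDerivAt_sqLog (t := t + 1) (by linarith)).comp t
      ((hasDerivAt_id t).add_const 1)).const_mul 2
    have d3 := hasDerivAt_sqLog ht'.ne'
    have d4 := Real.hasDerivAt_log ht'.ne'
    refine ((((d1.sub d2).add d3).div_const 2).sub d4).congr_deriv ?_
    ring
  refine antitoneOn_of_deriv_nonpos (convex_Ioi 0)
    (fun t ht => (hd t ht).continuousAt.continuousWithinAt) ?_ ?_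
  · rw [interior_Ioi]
    exact fun t ht => (hd t ht).differentiableAt.differentiableWithinAt
  · rw [interior_Ioi]
    intro t ht
    rw [(hd t ht).deriv]
    linarith [second_difference_le_inv ht]

/-- The integral of the decreasing function `log ((M + x + y) / (x + y))` over a unit square with
lower left corner on the line `x + y = s`. -/
theorem second_difference_le_log_sub_log {M s : ℝ} (hM : 0 ≤ M) (hs : 0 < s) :
    phiInt M (s + 2) - 2 * phiInt M (s + 1) + phiInt M s ≤ Real.log (M + s) - Real.log s := by
  have h := antitoneOn_second_difference_sub_log (Set.mem_Ioi.2 hs)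
    (Set.mem_Ioi.2 (by linarith : 0 < M + s)) (by linarith : s ≤ M + s)
  simp only [phiInt, ← add_assoc] at h ⊢
  linarith

theorem second_difference_nonneg {M s : ℝ} (hM : 0 ≤ M) (hs : 1 ≤ s) :
    0 ≤ phiInt M (s + 1) - 2 * phiInt M s + phiInt M (s - 1) :=
  (sub_nonneg.2 (Real.log_le_log (by linarith) (by linarith))).trans
    (log_sub_log_le_second_difference hM hs)

theorem blockValue_pos (m b : ℕ) : 0 < blockValue m b :=
  Finset.prod_pos fun l _ => Finset.prod_pos fun i _ => by positivity

theorem blockValue_succ (m b : ℕ) : blockValue m (b + 1) = blockValue m b *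
    ∏ i ∈ Finset.range b, ((2 * m + b + i + 1) / (b + i + 1) : ℝ) := by
  rw [blockValue, Finset.prod_range_succ, blockValue]

theorem log_blockValue_succ (m b : ℕ) : Real.log (blockValue m (b + 1)) =
    Real.log (blockValue m b) +
      ∑ i ∈ Finset.range b, (Real.log (2 * m + b + i + 1) - Real.log (b + i + 1)) := by
  rw [blockValue_succ, Real.log_mul (blockValue_pos m b).ne', Real.log_prod]
  · congr 1
    exact Finset.sum_congr rfl fun i _ => Real.log_div (by positivity) (by positivity)
  · exact fun i _ => by positivity
  · exact (Finset.prod_pos fun i _ => by positivity).ne'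

theorem blockIntegral_zero (m : ℝ) : blockIntegral m 0 = 0 := by
  simp only [blockIntegral, mul_zero]
  ring

/-- Unit squares with upper right corners shifted by `(0, 1)` from the lattice points fit into the
triangle, and the half squares left over along the diagonal contribute a nonnegative amount. -/
theorem log_blockValue_le (m b : ℕ) : Real.log (blockValue m b) ≤ blockIntegral m b := by
  induction b with
  | zero =>
    rw [Nat.cast_zero, blockIntegral_zero]
    simp [blockValue]
  | succ b ih =>
    rw [log_blockValue_succ]
    set P := phiInt (2 * m) with hP
    have hM : (0 : ℝ) ≤ 2 * m := by positivity
    have hsum : ∑ i ∈ Finset.range b, (Real.log (2 * m + b + i + 1) - Real.log (b + i + 1 : ℝ)) ≤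
        (P (2 * b + 1) - P (2 * b)) - (P (b + 1) - P b) := by
      have htel := Finset.sum_range_sub (fun i : ℕ => P ((b : ℝ) + i + 1) - P (b + i)) b
      simp only [Nat.cast_zero, add_zero, ← two_mul] at htel
      rw [← htel]
      refine Finset.sum_le_sum fun i _ => ?_
      have h := log_sub_log_le_second_difference hM (s := (b : ℝ) + i + 1)
        (by have : (0 : ℝ) ≤ b + i := by positivity
            linarith)
      simp only [← add_assoc] at h
      rw [show (b : ℝ) + i + 1 - 1 = b + i by ring] at h
      push_cast
      simp only [← add_assoc]
      linarith
    have hdiag := second_difference_nonneg hM (s := 2 * (b : ℝ) + 1)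
      (by have : (0 : ℝ) ≤ b := by positivity
          linarith)
    rw [show 2 * (b : ℝ) + 1 - 1 = 2 * b by ring, show 2 * (b : ℝ) + 1 + 1 = 2 * (b + 1) by ring]
      at hdiag
    have e1 : blockIntegral m ((b + 1 : ℕ) : ℝ) =
        (P (2 * (b + 1)) - 2 * P (b + 1) + P 0) / 2 := by
      rw [blockIntegral]; push_cast; rfl
    have e2 : blockIntegral m (b : ℝ) = (P (2 * b) - 2 * P b + P 0) / 2 := rfl
    rw [e1]
    rw [e2] at ih
    linarith

/-- Unit squares with lower left corners at the lattice points miss only the strip `x ≤ 1` of the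
triangle, and the sum over this strip telescopes. -/
theorem blockIntegral_sub_le (m b : ℕ) :
    blockIntegral m b - Real.log (blockValue m b) ≤
      (phiInt (2 * m) (b + 1) - phiInt (2 * m) b) - (phiInt (2 * m) 1 - phiInt (2 * m) 0) := by
  induction b with
  | zero =>
    rw [Nat.cast_zero, blockIntegral_zero]
    simp [blockValue]
  | succ b ih =>
    rw [log_blockValue_succ]
    set P := phiInt (2 * m) with hP
    have hM : (0 : ℝ) ≤ 2 * m := by positivity
    have hsum : (P (2 * b + 2) - P (2 * b + 1)) - (P (b + 2) - P (b + 1)) ≤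
        ∑ i ∈ Finset.range b, (Real.log (2 * m + b + i + 1) - Real.log (b + i + 1 : ℝ)) := by
      have htel := Finset.sum_range_sub (fun i : ℕ => P ((b : ℝ) + i + 2) - P (b + i + 1)) b
      simp only [Nat.cast_zero, add_zero, ← two_mul] at htel
      rw [← htel]
      refine Finset.sum_le_sum fun i _ => ?_
      have h := second_difference_le_log_sub_log hM (s := (b : ℝ) + i + 1) (by positivity)
      rw [show (b : ℝ) + i + 1 + 2 = b + (i + 1) + 2 by ring,
        show (b : ℝ) + i + 1 + 1 = b + (i + 1) + 1 by ring] at h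
      push_cast
      rw [show (b : ℝ) + (i + 1) + 1 = b + i + 2 by ring] at h ⊢
      simp only [← add_assoc] at h ⊢
      linarith
    have hdiag := second_difference_nonneg hM (s := 2 * (b : ℝ) + 1)
      (by have : (0 : ℝ) ≤ b := by positivity
          linarith)
    rw [show 2 * (b : ℝ) + 1 - 1 = 2 * b by ring, show 2 * (b : ℝ) + 1 + 1 = 2 * b + 2 by ring]
      at hdiag
    have e1 : blockIntegral m ((b + 1 : ℕ) : ℝ) =
        (P (2 * b + 2) - 2 * P (b + 1) + P 0) / 2 := by
      rw [blockIntegral]; push_cast; rw [show 2 * ((b : ℝ) + 1) = 2 * b + 2 by ring]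
    have e2 : blockIntegral m (b : ℝ) = (P (2 * b) - 2 * P b + P 0) / 2 := rfl
    rw [e1]
    rw [e2] at ih
    push_cast
    rw [show (b : ℝ) + 1 + 1 = b + 2 by ring]
    linarith

theorem phiInt_increment {M t : ℝ} (hM : 0 < M) (ht : 0 ≤ t) :
    ∃ s ∈ Set.Ioo t (t + 1), phiInt M (t + 1) - phiInt M t =
      (M + s) * Real.log (M + s) - s * Real.log s + M / 2 := by
  have hd : ∀ s ∈ Set.Ioo t (t + 1), HasDerivAt (phiInt M)
      ((M + s) * Real.log (M + s) - s * Real.log s + M / 2) s := by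
    intro s hs
    have hs0 : 0 < s := ht.trans_lt hs.1
    have d1 := (hasDerivAt_sqLog (t := M + s) (by linarith)).comp s ((hasDerivAt_id s).const_add M)
    refine ((d1.sub (hasDerivAt_sqLog hs0.ne')).div_const 2).congr_deriv ?_
    ring
  have hc : Continuous (phiInt M) := by
    unfold phiInt
    have := continuous_sqLog
    fun_prop
  obtain ⟨s, hs, h⟩ := exists_hasDerivAt_eq_slope (phiInt M) _ (by linarith : t < t + 1)
    hc.continuousOn hd
  refine ⟨s, hs, ?_⟩
  rw [h]
  simp

theorem blockIntegral_le (m b : ℕ) (hm : 0 < m) :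
    blockIntegral m b ≤ Real.log (blockValue m b) + (2 * m + b + 1) := by
  have h := blockIntegral_sub_le m b
  have hM : (0 : ℝ) < 2 * m := by positivity
  set M : ℝ := 2 * m with hMdef
  obtain ⟨s, hs, es⟩ := phiInt_increment hM (Nat.cast_nonneg b)
  obtain ⟨t, ht, et⟩ := phiInt_increment hM le_rfl
  rw [zero_add] at et
  have hs0 : 0 < s := (Nat.cast_nonneg b).trans_lt hs.1
  have ht0 : 0 < t := ht.1
  rw [es, et] at h
  have h1 : M * Real.log M + t * Real.log t ≤ (M + t) * Real.log (M + t) := by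
    have a1 := mul_le_mul_of_nonneg_left (Real.log_le_log hM (by linarith : M ≤ M + t)) hM.le
    have a2 := mul_le_mul_of_nonneg_left (Real.log_le_log ht0 (by linarith : t ≤ M + t)) ht0.le
    linarith
  have h2 : (M + s) * Real.log (M + s) ≤ s * Real.log s + M * Real.log M + (M + s) := by
    have key : ∀ x y : ℝ, 0 < x → 0 < y → x * Real.log (x + y) ≤ x * Real.log x + y := by
      intro x y hx hy
      have h3 := Real.log_le_sub_one_of_pos (x := (x + y) / x) (by positivity)
      rw [Real.log_div (by positivity) hx.ne'] at h3
      have h4 := mul_le_mul_of_nonneg_left h3 hx.le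
      have h5 : x * ((x + y) / x - 1) = y := by field_simp; ring
      linarith
    have k1 := key M s hM hs0
    have k2 := key s M hs0 hM
    rw [add_comm s M] at k2
    linarith
  have := hs.2
  linarith

/-! ### The critical equation -/

/-- The derivative of `f`. -/
def fDeriv (x : ℝ) : ℝ :=
  2 * (x * Real.log x) + (1 - x) * Real.log (1 - x) - (1 + x) * Real.log (1 + x) + 2 * Real.log 2

theorem hasDerivAt_f {x : ℝ} (h0 : 0 < x) (h1 : x < 1) : HasDerivAt f (fDeriv x) x := by
  have hf : f = fun x =>
      sqLog x - 1 / 2 * sqLog (1 - x) - 1 / 2 * sqLog (1 + x) + 2 * x * Real.log 2 :=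
    funext f_eq_sqLog
  have d1 := hasDerivAt_sqLog h0.ne'
  have d2 := ((hasDerivAt_sqLog (t := 1 - x) (by linarith)).comp x
    ((hasDerivAt_id x).const_sub 1)).const_mul (1 / 2)
  have d3 := ((hasDerivAt_sqLog (t := 1 + x) (by linarith)).comp x
    ((hasDerivAt_id x).const_add 1)).const_mul (1 / 2)
  have d4 := ((hasDerivAt_id x).const_mul 2).mul_const (Real.log 2)
  rw [hf]
  refine (((d1.sub d2).sub d3).add d4).congr_deriv ?_
  rw [fDeriv]
  ring

theorem continuous_f : Continuous f := by
  have hf : f = fun x =>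
      sqLog x - 1 / 2 * sqLog (1 - x) - 1 / 2 * sqLog (1 + x) + 2 * x * Real.log 2 :=
    funext f_eq_sqLog
  have := continuous_sqLog
  rw [hf]
  fun_prop

/-- `2 x f(x) + (1 - x²) f'(x)`, whose sign is that of the derivative of `f(x) / (1 - x²)`. -/
def critFun (x : ℝ) : ℝ :=
  2 * (x * Real.log x) + sqLog (1 - x) - sqLog (1 + x) + 2 * (1 + x ^ 2) * Real.log 2

theorem critFun_eq (x : ℝ) : critFun x = 2 * x * f x + (1 - x ^ 2) * fDeriv x := by
  simp only [critFun, f, fDeriv, sqLog]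
  ring

theorem continuous_critFun : Continuous critFun := by
  unfold critFun
  have h1 := continuous_sqLog
  have h2 := Real.continuous_mul_log
  fun_prop

/-- Half the derivative of `critFun`. -/
def critFunDeriv (x : ℝ) : ℝ :=
  Real.log x - (1 - x) * Real.log (1 - x) - (1 + x) * Real.log (1 + x) + 2 * x * Real.log 2

theorem hasDerivAt_critFun {x : ℝ} (h0 : 0 < x) (h1 : x < 1) :
    HasDerivAt critFun (2 * critFunDeriv x) x := by
  have d1 := (Real.hasDerivAt_mul_log h0.ne').const_mul 2
  have d2 := (hasDerivAt_sqLog (t := 1 - x) (by linarith)).comp x ((hasDerivAt_id x).const_sub 1)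
  have d3 := (hasDerivAt_sqLog (t := 1 + x) (by linarith)).comp x ((hasDerivAt_id x).const_add 1)
  have d4 := ((((hasDerivAt_id x).pow 2).const_add 1).const_mul 2).mul_const (Real.log 2)
  refine (((d1.add d2).sub d3).add d4).congr_deriv ?_
  rw [critFunDeriv]
  simp only [id]
  push_cast
  ring

theorem continuousOn_critFunDeriv : ContinuousOn critFunDeriv (Set.Ioi 0) := by
  have h1 : Continuous fun x : ℝ =>
      (1 - x) * Real.log (1 - x) + (1 + x) * Real.log (1 + x) - 2 * x * Real.log 2 := by
    have e1 : Continuous fun x : ℝ => (1 - x) * Real.log (1 - x) :=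
      Real.continuous_mul_log.comp (continuous_const.sub continuous_id)
    have e2 : Continuous fun x : ℝ => (1 + x) * Real.log (1 + x) :=
      Real.continuous_mul_log.comp (continuous_const.add continuous_id)
    fun_prop
  refine ((Real.continuousOn_log.mono fun x hx => ?_).sub h1.continuousOn).congr fun x _ => ?_
  · have : (0 : ℝ) < x := hx
    simpa using this.ne'
  · rw [critFunDeriv]
    simp only [Pi.sub_apply]
    ring

theorem hasDerivAt_critFunDeriv {x : ℝ} (h0 : 0 < x) (h1 : x < 1) :
    HasDerivAt critFunDeriv
      (1 / x + Real.log (1 - x) - Real.log (1 + x) + 2 * Real.log 2) x := by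
  have d1 := Real.hasDerivAt_log h0.ne'
  have d2 := (Real.hasDerivAt_mul_log (x := 1 - x) (by linarith)).comp x
    ((hasDerivAt_id x).const_sub 1)
  have d3 := (Real.hasDerivAt_mul_log (x := 1 + x) (by linarith)).comp x
    ((hasDerivAt_id x).const_add 1)
  have d4 := ((hasDerivAt_id x).const_mul 2).mul_const (Real.log 2)
  refine (((d1.sub d2).sub d3).add d4).congr_deriv ?_
  rw [one_div]
  ring

/-- `critFun` and its derivative vanish at `1` while its second derivative strictly decreases, so
by Rolle's theorem it has at most one zero in `(0, 1)`. -/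
theorem critFun_zero_unique {x y : ℝ} (hx0 : 0 < x) (hxy : x < y) (hy1 : y < 1)
    (hx : critFun x = 0) (hy : critFun y = 0) : False := by
  have h1 : critFun 1 = 0 := by
    simp only [critFun, sqLog]
    norm_num
  have hD1 : critFunDeriv 1 = 0 := by
    simp only [critFunDeriv]
    norm_num
  have rolle : ∀ a b : ℝ, 0 < a → a < b → b ≤ 1 → critFun a = critFun b →
      ∃ c ∈ Set.Ioo a b, critFunDeriv c = 0 := by
    intro a b ha hab hb h
    obtain ⟨c, hc, hc'⟩ := exists_hasDerivAt_eq_zero (f := critFun)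
      (f' := fun c => 2 * critFunDeriv c) hab continuous_critFun.continuousOn h
      (fun c hc => hasDerivAt_critFun (ha.trans hc.1) (hc.2.trans_le hb))
    exact ⟨c, hc, by linarith⟩
  have rolle' : ∀ a b : ℝ, 0 < a → a < b → b ≤ 1 → critFunDeriv a = critFunDeriv b →
      ∃ c ∈ Set.Ioo a b, 1 / c + Real.log (1 - c) - Real.log (1 + c) + 2 * Real.log 2 = 0 := by
    intro a b ha hab hb h
    exact exists_hasDerivAt_eq_zero hab
      (continuousOn_critFunDeriv.mono fun c hc => ha.trans_le hc.1) h
      (fun c hc => hasDerivAt_critFunDeriv (ha.trans hc.1) (hc.2.trans_le hb))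
  obtain ⟨c, hc, hc0⟩ := rolle x y hx0 hxy hy1.le (hx.trans hy.symm)
  obtain ⟨d, hd, hd0⟩ := rolle y 1 (hx0.trans hxy) hy1 le_rfl (hy.trans h1.symm)
  have hc_pos := hx0.trans hc.1
  have hcd := hc.2.trans hd.1
  obtain ⟨p, hp, hp0⟩ := rolle' c d hc_pos hcd hd.2.le (hc0.trans hd0.symm)
  obtain ⟨q, hq, hq0⟩ := rolle' d 1 (hc_pos.trans hcd) hd.2 le_rfl (hd0.trans hD1.symm)
  have hpq : p < q := hp.2.trans hq.1
  have hp_pos := hc_pos.trans hp.1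
  have i1 : 1 / q < 1 / p := one_div_lt_one_div_of_lt hp_pos hpq
  have i2 : Real.log (1 - q) < Real.log (1 - p) :=
    Real.log_lt_log (by linarith [hq.2]) (by linarith)
  have i3 : Real.log (1 + p) < Real.log (1 + q) := Real.log_lt_log (by linarith) (by linarith)
  linarith

/-! ### Numerical bounds -/

theorem log_ratio_bounds {u : ℝ} (h0 : 0 ≤ u) (h1 : u < 1) (n : ℕ) :
    2 * ∑ i ∈ Finset.range n, u ^ (2 * i + 1) / (2 * i + 1) ≤ Real.log ((1 + u) / (1 - u)) ∧
      Real.log ((1 + u) / (1 - u)) ≤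
        2 * (∑ i ∈ Finset.range n, u ^ (2 * i + 1) / (2 * i + 1) +
          u ^ (2 * n + 1) / (1 - u ^ 2)) := by
  have h2 := Real.sum_range_le_log_div h0 h1 n
  have h3 := Real.log_div_le_sum_range_add h0 h1 n
  constructor <;> linarith

theorem log_two_bounds :
    0.693147180559945 ≤ Real.log 2 ∧ Real.log 2 ≤ 0.693147180559946 := by
  have h := log_ratio_bounds (u := 1 / 3) (by norm_num) (by norm_num) 17
  rw [show (1 + 1 / 3 : ℝ) / (1 - 1 / 3) = 2 by norm_num] at h
  refine ⟨le_trans ?_ h.1, h.2.trans ?_⟩ <;> norm_num [Finset.sum_range_succ]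

theorem log_thirty_div_thirteen_bounds :
    0.836248024200618 ≤ Real.log (30 / 13) ∧ Real.log (30 / 13) ≤ 0.836248024200619 := by
  have h := log_ratio_bounds (u := 17 / 43) (by norm_num) (by norm_num) 21
  rw [show (1 + 17 / 43 : ℝ) / (1 - 17 / 43) = 30 / 13 by norm_num] at h
  refine ⟨le_trans ?_ h.1, h.2.trans ?_⟩ <;> norm_num [Finset.sum_range_succ]

theorem log_thirty_div_seventeen_bounds :
    0.567984037605939 ≤ Real.log (30 / 17) ∧ Real.log (30 / 17) ≤ 0.567984037605940 := by
  have h := log_ratio_bounds (u := 13 / 47) (by norm_num) (by norm_num) 15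
  rw [show (1 + 13 / 47 : ℝ) / (1 - 13 / 47) = 30 / 17 by norm_num] at h
  refine ⟨le_trans ?_ h.1, h.2.trans ?_⟩ <;> norm_num [Finset.sum_range_succ]

theorem log_forty_three_div_thirty_bounds :
    0.360002734031407 ≤ Real.log (43 / 30) ∧ Real.log (43 / 30) ≤ 0.360002734031408 := by
  have h := log_ratio_bounds (u := 13 / 73) (by norm_num) (by norm_num) 11
  rw [show (1 + 13 / 73 : ℝ) / (1 - 13 / 73) = 43 / 30 by norm_num] at h
  refine ⟨le_trans ?_ h.1, h.2.trans ?_⟩ <;> norm_num [Finset.sum_range_succ]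

/-- Logarithms at the lower end of an interval around the root, through the nearby rationals
`13/30`, `17/30` and `43/30`. -/
theorem log_bounds_lower_end :
    (-0.836597705663982 ≤ Real.log 0.4331818311895 ∧
      Real.log 0.4331818311895 ≤ -0.836597705663976) ∧
    (-0.567716716614970 ≤ Real.log (1 - 0.4331818311895) ∧
      Real.log (1 - 0.4331818311895) ≤ -0.567716716614965) ∧
    (0.359897029274737 ≤ Real.log (1 + 0.4331818311895) ∧
      Real.log (1 + 0.4331818311895) ≤ 0.359897029274742) := by
  obtain ⟨h1, h1'⟩ := log_thirty_div_thirteen_bounds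
  obtain ⟨h2, h2'⟩ := log_thirty_div_seventeen_bounds
  obtain ⟨h3, h3'⟩ := log_forty_three_div_thirty_bounds
  obtain ⟨g1, g1'⟩ := log_ratio_bounds (u := 909012863 / 5199090987137) (by norm_num) (by norm_num) 2
  obtain ⟨g2, g2'⟩ := log_ratio_bounds (u := 909012863 / 6800909012863) (by norm_num) (by norm_num) 2
  obtain ⟨g3, g3'⟩ := log_ratio_bounds (u := 909012863 / 17199090987137) (by norm_num) (by norm_num) 2
  rw [show (1 + 909012863 / 5199090987137 : ℝ) / (1 - 909012863 / 5199090987137) =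
    (30 / 13)⁻¹ / 0.4331818311895 by norm_num, Real.log_div (by norm_num) (by norm_num),
    Real.log_inv] at g1 g1'
  rw [show (1 + 909012863 / 6800909012863 : ℝ) / (1 - 909012863 / 6800909012863) =
    (1 - 0.4331818311895) * (30 / 17) by norm_num, Real.log_mul (by norm_num) (by norm_num)]
    at g2 g2'
  rw [show (1 + 909012863 / 17199090987137 : ℝ) / (1 - 909012863 / 17199090987137) =
    (43 / 30) / (1 + 0.4331818311895) by norm_num, Real.log_div (by norm_num) (by norm_num)]
    at g3 g3'
  norm_num [Finset.sum_range_succ] at g1 g1' g2 g2' g3 g3'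
  norm_num at h1 h1' h2 h2' h3 h3' ⊢
  refine ⟨⟨?_, ?_⟩, ⟨?_, ?_⟩, ?_, ?_⟩ <;> linarith

theorem log_bounds_upper_end :
    (-0.836597705661674 ≤ Real.log 0.4331818311905 ∧
      Real.log 0.4331818311905 ≤ -0.836597705661668) ∧
    (-0.567716716616735 ≤ Real.log (1 - 0.4331818311905) ∧
      Real.log (1 - 0.4331818311905) ≤ -0.567716716616729) ∧
    (0.359897029275435 ≤ Real.log (1 + 0.4331818311905) ∧
      Real.log (1 + 0.4331818311905) ≤ 0.359897029275440) := by
  obtain ⟨h1, h1'⟩ := log_thirty_div_thirteen_bounds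
  obtain ⟨h2, h2'⟩ := log_thirty_div_seventeen_bounds
  obtain ⟨h3, h3'⟩ := log_forty_three_div_thirty_bounds
  obtain ⟨g1, g1'⟩ := log_ratio_bounds (u := 909012857 / 5199090987143) (by norm_num) (by norm_num) 2
  obtain ⟨g2, g2'⟩ := log_ratio_bounds (u := 909012857 / 6800909012857) (by norm_num) (by norm_num) 2
  obtain ⟨g3, g3'⟩ := log_ratio_bounds (u := 909012857 / 17199090987143) (by norm_num) (by norm_num) 2
  rw [show (1 + 909012857 / 5199090987143 : ℝ) / (1 - 909012857 / 5199090987143) =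
    (30 / 13)⁻¹ / 0.4331818311905 by norm_num, Real.log_div (by norm_num) (by norm_num),
    Real.log_inv] at g1 g1'
  rw [show (1 + 909012857 / 6800909012857 : ℝ) / (1 - 909012857 / 6800909012857) =
    (1 - 0.4331818311905) * (30 / 17) by norm_num, Real.log_mul (by norm_num) (by norm_num)]
    at g2 g2'
  rw [show (1 + 909012857 / 17199090987143 : ℝ) / (1 - 909012857 / 17199090987143) =
    (43 / 30) / (1 + 0.4331818311905) by norm_num, Real.log_div (by norm_num) (by norm_num)]
    at g3 g3'
  norm_num [Finset.sum_range_succ] at g1 g1' g2 g2' g3 g3'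
  norm_num at h1 h1' h2 h2' h3 h3' ⊢
  refine ⟨⟨?_, ?_⟩, ⟨?_, ?_⟩, ?_, ?_⟩ <;> linarith

theorem critFun_lower_end_pos : 0 < critFun 0.4331818311895 := by
  obtain ⟨⟨h1, -⟩, ⟨h2, -⟩, -, h3⟩ := log_bounds_lower_end
  have h4 := log_two_bounds.1
  simp only [critFun, sqLog]
  norm_num at h1 h2 h3 h4 ⊢
  linarith

theorem critFun_upper_end_neg : critFun 0.4331818311905 < 0 := by
  obtain ⟨⟨-, h1⟩, ⟨-, h2⟩, h3, -⟩ := log_bounds_upper_end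
  have h4 := log_two_bounds.2
  simp only [critFun, sqLog]
  norm_num at h1 h2 h3 h4 ⊢
  linarith

/-- The interval has width `10⁻¹²`, so that monotone bounds for the terms of `f` at its ends determine
`γ` well within `10⁻¹⁰`. -/
theorem exists_critFun_eq_zero :
    ∃ x : ℝ, 0.4331818311895 < x ∧ x < 0.4331818311905 ∧ critFun x = 0 := by
  obtain ⟨x, hx, h⟩ := intermediate_value_Ioo' (by norm_num) continuous_critFun.continuousOn
    ⟨critFun_upper_end_neg, critFun_lower_end_pos⟩
  exact ⟨x, hx.1, hx.2, h⟩

/-- The constant `α`, the zero of `critFun` in `(0, 1)`. -/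
def alpha : ℝ := exists_critFun_eq_zero.choose

theorem lt_alpha : 0.4331818311895 < alpha := exists_critFun_eq_zero.choose_spec.1

theorem alpha_lt : alpha < 0.4331818311905 := exists_critFun_eq_zero.choose_spec.2.1

theorem critFun_alpha : critFun alpha = 0 := exists_critFun_eq_zero.choose_spec.2.2

theorem alpha_pos : 0 < alpha := lt_trans (by norm_num) lt_alpha

theorem alpha_lt_one : alpha < 1 := alpha_lt.trans (by norm_num)

theorem eq_alpha_of_critFun_eq_zero {x : ℝ} (h0 : 0 < x) (h1 : x < 1) (h : critFun x = 0) :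
    x = alpha := by
  rcases lt_trichotomy x alpha with hlt | heq | hgt
  · exact (critFun_zero_unique h0 hlt alpha_lt_one h critFun_alpha).elim
  · exact heq
  · exact (critFun_zero_unique alpha_pos hgt h1 critFun_alpha h).elim

theorem critFun_pos {x : ℝ} (h0 : 0 < x) (h1 : x < alpha) : 0 < critFun x := by
  by_contra h
  rcases (not_lt.mp h).lt_or_eq with hneg | hz
  · rcases lt_or_ge x 0.4331818311895 with hx | hx
    · obtain ⟨y, hy, hy0⟩ := intermediate_value_Ioo hx.le continuous_critFun.continuousOn
        ⟨hneg, critFun_lower_end_pos⟩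
      have := eq_alpha_of_critFun_eq_zero (h0.trans hy.1) (hy.2.trans (by norm_num)) hy0
      linarith [hy.2, lt_alpha]
    · rcases hx.lt_or_eq with hx | hx
      · obtain ⟨y, hy, hy0⟩ := intermediate_value_Ioo' hx.le continuous_critFun.continuousOn
          ⟨hneg, critFun_lower_end_pos⟩
        have := eq_alpha_of_critFun_eq_zero (lt_trans (by norm_num) hy.1)
          (hy.2.trans (h1.trans alpha_lt_one)) hy0
        linarith [hy.2]
      · rw [← hx] at hneg
        exact absurd critFun_lower_end_pos (not_lt.mpr hneg.le)
  · exact h1.ne (eq_alpha_of_critFun_eq_zero h0 (h1.trans alpha_lt_one) hz)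

theorem critFun_neg {x : ℝ} (h0 : alpha < x) (h1 : x < 1) : critFun x < 0 := by
  have hx0 := alpha_pos.trans h0
  by_contra h
  rcases (not_lt.mp h).lt_or_eq with hpos | hz
  · rcases lt_or_ge 0.4331818311905 x with hx | hx
    · obtain ⟨y, hy, hy0⟩ := intermediate_value_Ioo hx.le continuous_critFun.continuousOn
        ⟨critFun_upper_end_neg, hpos⟩
      have := eq_alpha_of_critFun_eq_zero (lt_trans (by norm_num) hy.1) (hy.2.trans h1) hy0
      linarith [hy.1, alpha_lt]
    · rcases hx.lt_or_eq with hx | hx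
      · obtain ⟨y, hy, hy0⟩ := intermediate_value_Ioo' hx.le continuous_critFun.continuousOn
          ⟨critFun_upper_end_neg, hpos⟩
        have := eq_alpha_of_critFun_eq_zero (hx0.trans hy.1) (hy.2.trans (by norm_num)) hy0
        linarith [hy.1]
      · rw [hx] at hpos
        exact absurd critFun_upper_end_neg (not_lt.mpr hpos.le)
  · exact h0.ne' (eq_alpha_of_critFun_eq_zero hx0 h1 hz.symm)

/-- The constant `γ`, the maximum of `f(x) / (1 - x²)` on `(0, 1)`. -/
def gammaConst : ℝ := f alpha / (1 - alpha ^ 2)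

theorem hasDerivAt_f_div {x : ℝ} (h0 : 0 < x) (h1 : x < 1) :
    HasDerivAt (fun x => f x / (1 - x ^ 2)) (critFun x / (1 - x ^ 2) ^ 2) x := by
  have hne : 1 - x ^ 2 ≠ 0 := by nlinarith
  refine ((hasDerivAt_f h0 h1).div ((hasDerivAt_pow 2 x).const_sub 1) hne).congr_deriv ?_
  rw [critFun_eq]
  push_cast
  ring

theorem continuousOn_f_div : ContinuousOn (fun x => f x / (1 - x ^ 2)) (Set.Ico 0 1) := by
  refine continuous_f.continuousOn.div (by fun_prop) fun x hx => ?_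
  nlinarith [hx.1, hx.2]

theorem strictMonoOn_f_div : StrictMonoOn (fun x => f x / (1 - x ^ 2)) (Set.Icc 0 alpha) := by
  refine strictMonoOn_of_deriv_pos (convex_Icc _ _)
    (continuousOn_f_div.mono fun x hx => ⟨hx.1, hx.2.trans_lt alpha_lt_one⟩) ?_
  rw [interior_Icc]
  intro x hx
  have hx1 := hx.2.trans alpha_lt_one
  rw [(hasDerivAt_f_div hx.1 hx1).deriv]
  have : 0 < 1 - x ^ 2 := by nlinarith [hx.1]
  have := critFun_pos hx.1 hx.2
  positivity

theorem strictAntiOn_f_div : StrictAntiOn (fun x => f x / (1 - x ^ 2)) (Set.Ico alpha 1) := by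
  refine strictAntiOn_of_deriv_neg (convex_Ico _ _)
    (continuousOn_f_div.mono fun x hx => ⟨alpha_pos.le.trans hx.1, hx.2⟩) ?_
  rw [interior_Ico]
  intro x hx
  have hx0 := alpha_pos.trans hx.1
  rw [(hasDerivAt_f_div hx0 hx.2).deriv]
  have : 0 < 1 - x ^ 2 := by nlinarith [hx.2]
  exact div_neg_of_neg_of_pos (critFun_neg hx.1 hx.2) (by positivity)

theorem f_one : f 1 = 0 := by
  simp only [f]
  norm_num

/-- Away from `α`, the function `f` is bounded by a smaller multiple of `1 - x²`. -/
theorem exists_f_le_sub_mul {η : ℝ} (hη : 0 < η) :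
    ∃ c > 0, ∀ x ∈ Set.Icc (0 : ℝ) 1, η ≤ |x - alpha| → f x ≤ (gammaConst - c) * (1 - x ^ 2) := by
  have ha0 := alpha_pos
  have ha1 := alpha_lt_one
  set δ := min η (min (alpha / 2) ((1 - alpha) / 2)) with hδ
  have hδ0 : 0 < δ := lt_min hη (lt_min (by linarith) (by linarith))
  have hδη : δ ≤ η := min_le_left _ _
  have hδ1 : δ ≤ alpha / 2 := (min_le_right _ _).trans (min_le_left _ _)
  have hδ2 : δ ≤ (1 - alpha) / 2 := (min_le_right _ _).trans (min_le_right _ _)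
  set q : ℝ → ℝ := fun x => f x / (1 - x ^ 2) with hq
  have hγ : gammaConst = q alpha := rfl
  have hl : q (alpha - δ) < gammaConst :=
    strictMonoOn_f_div ⟨by linarith, by linarith⟩ ⟨ha0.le, le_rfl⟩ (by linarith)
  have hr : q (alpha + δ) < gammaConst :=
    strictAntiOn_f_div ⟨le_rfl, ha1⟩ ⟨by linarith, by linarith⟩ (by linarith)
  refine ⟨gammaConst - max (q (alpha - δ)) (q (alpha + δ)), sub_pos.2 (max_lt hl hr), ?_⟩
  intro x hx hxα
  rw [sub_sub_cancel]
  rcases hx.2.lt_or_eq with hx1 | rfl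
  swap
  · rw [f_one]; simp
  have hpos : 0 < 1 - x ^ 2 := by nlinarith [hx.1]
  rw [← div_le_iff₀ hpos]
  rcases le_abs.mp (hδη.trans hxα) with h | h
  · refine le_trans ?_ (le_max_right _ _)
    exact strictAntiOn_f_div.antitoneOn ⟨by linarith, by linarith⟩ ⟨by linarith, hx1⟩ (by linarith)
  · refine le_trans ?_ (le_max_left _ _)
    exact strictMonoOn_f_div.monotoneOn ⟨hx.1, by linarith⟩ ⟨by linarith, by linarith⟩ (by linarith)

theorem f_le_gammaConst_mul {x : ℝ} (hx : x ∈ Set.Icc (0 : ℝ) 1) :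
    f x ≤ gammaConst * (1 - x ^ 2) := by
  rcases eq_or_ne x alpha with rfl | hne
  · have : 0 < 1 - alpha ^ 2 := by nlinarith [alpha_pos, alpha_lt_one]
    rw [gammaConst, div_mul_cancel₀ _ this.ne']
  · obtain ⟨c, hc, h⟩ := exists_f_le_sub_mul (abs_pos.2 (sub_ne_zero.2 hne))
    have h1 := h x hx le_rfl
    have h2 : 0 ≤ 1 - x ^ 2 := by nlinarith [hx.1, hx.2]
    nlinarith

theorem abs_alpha_sub_lt : |alpha - 0.4331818312| < 1 / 10 ^ 10 := by
  rw [abs_lt]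
  have h1 := lt_alpha
  have h2 := alpha_lt
  norm_num at h1 h2 ⊢
  constructor <;> linarith

theorem f_alpha_bounds : 0.16511564042 ≤ f alpha ∧ f alpha ≤ 0.16511564045 := by
  obtain ⟨⟨p1, -⟩, ⟨-, q1⟩, ⟨r1, -⟩⟩ := log_bounds_lower_end
  obtain ⟨⟨-, p2⟩, ⟨q2, -⟩, ⟨-, r2⟩⟩ := log_bounds_upper_end
  obtain ⟨w1, w2⟩ := log_two_bounds
  have h1 := lt_alpha
  have h2 := alpha_lt
  have a1 : Real.log 0.4331818311895 ≤ Real.log alpha := Real.log_le_log (by norm_num) h1.le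
  have a2 : Real.log alpha ≤ Real.log 0.4331818311905 := Real.log_le_log alpha_pos h2.le
  have b1 : Real.log (1 - 0.4331818311905) ≤ Real.log (1 - alpha) :=
    Real.log_le_log (by norm_num) (by linarith)
  have b2 : Real.log (1 - alpha) ≤ Real.log (1 - 0.4331818311895) :=
    Real.log_le_log (by linarith [alpha_lt_one]) (by linarith)
  have c1 : Real.log (1 + 0.4331818311895) ≤ Real.log (1 + alpha) :=
    Real.log_le_log (by norm_num) (by linarith)
  have c2 : Real.log (1 + alpha) ≤ Real.log (1 + 0.4331818311905) :=
    Real.log_le_log (by linarith [alpha_pos]) (by linarith)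
  have key : ∀ x y l u a b : ℝ, 0 ≤ l → l ≤ x → x ≤ u → 0 ≤ a → a ≤ y → y ≤ b →
      l ^ 2 * a ≤ x ^ 2 * y ∧ x ^ 2 * y ≤ u ^ 2 * b := by
    intro x y l u a b h1 h2 h3 h4 h5 h6
    have hx := h1.trans h2
    have hy := h4.trans h5
    exact ⟨by gcongr, by gcongr⟩
  obtain ⟨k1, k1'⟩ := key alpha (-Real.log alpha) 0.4331818311895 0.4331818311905
    0.836597705661668 0.836597705663982 (by norm_num) h1.le h2.le (by norm_num) (by linarith)
    (by linarith)
  obtain ⟨k2, k2'⟩ := key (1 - alpha) (-Real.log (1 - alpha)) (1 - 0.4331818311905)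
    (1 - 0.4331818311895) 0.567716716614965 0.567716716616735 (by norm_num) (by linarith)
    (by linarith) (by norm_num) (by linarith) (by linarith)
  obtain ⟨k3, k3'⟩ := key (1 + alpha) (Real.log (1 + alpha)) (1 + 0.4331818311895)
    (1 + 0.4331818311905) 0.359897029274737 0.359897029275440 (by norm_num) (by linarith)
    (by linarith) (by norm_num) (by linarith) (by linarith)
  have k4 : 0.4331818311895 * 0.693147180559945 ≤ alpha * Real.log 2 :=
    mul_le_mul h1.le w1 (by norm_num) alpha_pos.le
  have k4' : alpha * Real.log 2 ≤ 0.4331818311905 * 0.693147180559946 :=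
    mul_le_mul h2.le w2 (by linarith) (by norm_num)
  have hf : f alpha = -(alpha ^ 2 * -Real.log alpha) + 1 / 2 * ((1 - alpha) ^ 2 *
      -Real.log (1 - alpha)) - 1 / 2 * ((1 + alpha) ^ 2 * Real.log (1 + alpha)) +
      2 * (alpha * Real.log 2) := by
    rw [f]; ring
  rw [hf]
  norm_num only at k1 k1' k2 k2' k3 k3' k4 k4' ⊢
  constructor <;> linarith

theorem gammaConst_bounds : 0.2032558980 < gammaConst ∧ gammaConst < 0.2032558982 ∧
    |gammaConst - 0.2032558981| < 1 / 10 ^ 10 ∧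
    |gammaConst / Real.log 2 - 0.2932362762| < 1 / 10 ^ 10 := by
  obtain ⟨h1, h2⟩ := f_alpha_bounds
  obtain ⟨w1, w2⟩ := log_two_bounds
  have l1 := lt_alpha
  have l2 := alpha_lt
  have s1 : 0.4331818311895 ^ 2 ≤ alpha ^ 2 := by gcongr
  have s2 : alpha ^ 2 ≤ 0.4331818311905 ^ 2 := by
    have := alpha_pos
    gcongr
  have hpos : 0 < 1 - alpha ^ 2 := by
    norm_num at s2
    linarith
  have g1 : 0.20325589805 < gammaConst := by
    rw [gammaConst, lt_div_iff₀ hpos]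
    norm_num at s1 h1 ⊢
    linarith
  have g2 : gammaConst < 0.20325589812 := by
    rw [gammaConst, div_lt_iff₀ hpos]
    norm_num at s2 h2 ⊢
    linarith
  have hlog : 0 < Real.log 2 := by linarith
  refine ⟨by linarith, by linarith, ?_, ?_⟩
  · rw [abs_lt]
    norm_num at g1 g2 ⊢
    constructor <;> linarith
  · rw [abs_lt]
    constructor
    · rw [lt_sub_iff_add_lt, lt_div_iff₀ hlog]
      norm_num at g1 w2 ⊢
      linarith
    · rw [sub_lt_iff_lt_add, div_lt_iff₀ hlog]
      norm_num at g2 w1 ⊢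
      linarith

/-- An upper bound for the loss caused by a ratio slightly smaller than `α`. -/
theorem gammaConst_mul_sub_f_le {x : ℝ} (h1 : alpha - 1 / 20 ≤ x) (h2 : x ≤ alpha) :
    gammaConst * (1 - x ^ 2) - f x ≤ 1 / 2 * (alpha - x) := by
  have l1 := lt_alpha
  have l2 := alpha_lt
  norm_num at l1 l2
  have hγ := gammaConst_bounds.2.1
  have hpos : 0 < 1 - alpha ^ 2 := by nlinarith
  have hα : gammaConst * (1 - alpha ^ 2) - f alpha = 0 := by
    rw [gammaConst, div_mul_cancel₀ _ hpos.ne', sub_self]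
  rcases h2.eq_or_lt with rfl | hlt
  · rw [hα]; simp
  have hd : ∀ y ∈ Set.Ioo x alpha, HasDerivAt (fun y => gammaConst * (1 - y ^ 2) - f y)
      (gammaConst * (-(2 * y)) - fDeriv y) y := by
    intro y hy
    refine ((((hasDerivAt_pow 2 y).const_sub 1).const_mul gammaConst).sub
      (hasDerivAt_f (by linarith [hy.1]) (by linarith [hy.2]))).congr_deriv ?_
    push_cast
    ring
  have hc : Continuous fun y => gammaConst * (1 - y ^ 2) - f y := by
    have := continuous_f
    fun_prop
  obtain ⟨y, hy, h⟩ := exists_hasDerivAt_eq_slope _ _ hlt hc.continuousOn hd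
  rw [eq_div_iff (by linarith), hα] at h
  have y1 : 0.38 ≤ y := by norm_num; linarith [hy.1]
  have y2 : y ≤ 0.44 := by norm_num; linarith [hy.2]
  norm_num at y1 y2
  have hy0 : 0 < y := by linarith
  -- crude bounds for the logarithms suffice here
  have e1 : y * Real.log y ≤ y * (y - 1) :=
    mul_le_mul_of_nonneg_left (Real.log_le_sub_one_of_pos hy0) hy0.le
  have e2 : (1 - y) * Real.log (1 - y) ≤ (1 - y) * (1 - y - 1) :=
    mul_le_mul_of_nonneg_left (Real.log_le_sub_one_of_pos (by linarith)) (by linarith)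
  have e3 : y ≤ (1 + y) * Real.log (1 + y) := by
    have := mul_le_mul_of_nonneg_left (Real.one_sub_inv_le_log_of_pos (x := 1 + y) (by linarith))
      (by linarith : 0 ≤ 1 + y)
    rwa [mul_sub, mul_inv_cancel₀ (by linarith), mul_one, add_sub_cancel_left] at this
  have e4 := log_two_bounds.2
  have hD : fDeriv y ≤ 3 / 10 + 1 / 100 := by
    rw [fDeriv]
    norm_num at e4
    nlinarith
  have hG : gammaConst * (2 * y) ≤ 0.19 := by
    norm_num at hγ ⊢
    nlinarith
  norm_num at hG
  nlinarith

/-! ### The maximum over layered permutations -/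

theorem listValue_pos (L : List ℕ) : 0 < listValue L := by
  induction L with
  | nil => exact one_pos
  | cons b L ih => exact mul_pos (blockValue_pos _ _) ih

theorem log_listValue_cons (b : ℕ) (L : List ℕ) : Real.log (listValue (b :: L)) =
    Real.log (blockValue L.sum b) + Real.log (listValue L) := by
  rw [listValue, Real.log_mul (blockValue_pos _ _).ne' (listValue_pos _).ne']

theorem listValue_le_v {L : List ℕ} (hL : ∀ b ∈ L, 0 < b) : listValue L ≤ v L.sum := by
  let c : Composition L.sum :=
    ⟨L.reverse, fun {i} hi => hL i (List.mem_reverse.1 hi), by rw [List.sum_reverse]⟩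
  have h := upsilon_layeredPerm c
  rw [show c.blocks.reverse = L from List.reverse_reverse L] at h
  rw [← h]
  exact_mod_cast Finset.le_sup' upsilon (Finset.mem_image_of_mem layeredPerm (Finset.mem_univ c))

theorem exists_listValue_eq_v (n : ℕ) :
    ∃ L : List ℕ, (∀ b ∈ L, 0 < b) ∧ L.sum = n ∧ listValue L = v n := by
  obtain ⟨w, hw, h⟩ := Finset.exists_mem_eq_sup' (layeredPerms_nonempty n) upsilon
  obtain ⟨c, -, rfl⟩ := Finset.mem_image.1 hw
  refine ⟨c.blocks.reverse, fun b hb => c.blocks_pos (List.mem_reverse.1 hb), ?_, ?_⟩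
  · rw [List.sum_reverse, c.blocks_sum]
  · rw [← upsilon_layeredPerm, v, h]

theorem log_listValue_le_log_v {L : List ℕ} (hL : ∀ b ∈ L, 0 < b) :
    Real.log (listValue L) ≤ Real.log (v L.sum) :=
  Real.log_le_log (listValue_pos L) (listValue_le_v hL)

/-- A new block may be put in front of an optimal list. -/
theorem log_blockValue_add_log_v_le (m : ℕ) {b : ℕ} (hb : 0 < b) :
    Real.log (blockValue m b) + Real.log (v m) ≤ Real.log (v (m + b)) := by
  obtain ⟨L, hL, rfl, h⟩ := exists_listValue_eq_v m
  have h1 := log_listValue_le_log_v (L := b :: L) (by simpa using ⟨hb, hL⟩)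
  rw [log_listValue_cons, h, List.sum_cons, add_comm b] at h1
  exact h1

theorem log_v_nonneg (n : ℕ) : 0 ≤ Real.log (v n) := by
  rcases Nat.eq_zero_or_pos n with rfl | hn
  · have h := log_listValue_le_log_v (L := []) (by simp)
    simpa [listValue] using h
  · have h := log_listValue_le_log_v (L := [n]) (by simpa using hn)
    have h1 : blockValue 0 n = 1 := by
      rw [blockValue]
      refine Finset.prod_eq_one fun l _ => Finset.prod_eq_one fun i _ => ?_
      rw [Nat.cast_zero, mul_zero, zero_add]
      exact div_self (by positivity)
    simpa [listValue, h1] using h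

theorem log_blockValue_le_of_f_le {m b : ℕ} {g : ℝ} (hn : 0 < m + b)
    (h : f (m / (m + b)) ≤ g * (1 - (m / (m + b) : ℝ) ^ 2)) :
    Real.log (blockValue m b) ≤ g * ((m + b : ℝ) ^ 2 - (m : ℝ) ^ 2) := by
  have hn' : (0 : ℝ) < m + b := by exact_mod_cast hn
  refine (log_blockValue_le m b).trans ?_
  rw [blockIntegral_eq _ _ hn']
  refine (mul_le_mul_of_nonneg_left h (by positivity)).trans_eq ?_
  field_simp

theorem div_add_mem_Icc (m b : ℕ) : (m / (m + b) : ℝ) ∈ Set.Icc (0 : ℝ) 1 :=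
  ⟨by positivity, div_le_one_of_le₀ (by linarith [(Nat.cast_nonneg b : (0 : ℝ) ≤ b)]) (by positivity)⟩

theorem log_listValue_le {L : List ℕ} (hL : ∀ b ∈ L, 0 < b) :
    Real.log (listValue L) ≤ gammaConst * (L.sum : ℝ) ^ 2 := by
  induction L with
  | nil => simp [listValue]
  | cons b L ih =>
    have hb := hL b (by simp)
    have h1 := log_blockValue_le_of_f_le (m := L.sum) (b := b) (by omega)
      (f_le_gammaConst_mul (div_add_mem_Icc _ _))
    have h2 := ih fun x hx => hL x (by simp [hx])
    rw [log_listValue_cons, List.sum_cons, Nat.cast_add, add_comm (b : ℝ)]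
    linarith

theorem log_v_le (n : ℕ) : Real.log (v n) ≤ gammaConst * (n : ℝ) ^ 2 := by
  obtain ⟨L, hL, rfl, h⟩ := exists_listValue_eq_v n
  rw [← h]
  exact log_listValue_le hL

/-- The first block is chosen so that `m = ⌊α n⌋` remains; the errors `n / 2` (rounding) and
`2 m + b + 1` (comparison with the integral) are together at most `4 (n - m)` for `n ≥ 20`. -/
theorem le_log_v (n : ℕ) : gammaConst * (n : ℝ) ^ 2 - 4 * n ≤ Real.log (v n) := by
  induction n using Nat.strong_induction_on with
  | _ n ih =>
    have hγ := gammaConst_bounds.2.1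
    norm_num at hγ
    rcases lt_or_ge n 20 with hn | hn
    · -- `γ n ≤ 4` for these `n`
      have hn' : (n : ℝ) ≤ 19 := by exact_mod_cast Nat.lt_succ_iff.1 hn
      have h0 : (0 : ℝ) ≤ n := Nat.cast_nonneg n
      have := log_v_nonneg n
      nlinarith
    · have hn' : (20 : ℝ) ≤ n := by exact_mod_cast hn
      have ha0 := lt_alpha
      have ha1 := alpha_lt
      norm_num at ha0 ha1
      set m := ⌊alpha * n⌋₊ with hm
      have hm1 : (m : ℝ) ≤ alpha * n := Nat.floor_le (by have := alpha_pos; positivity)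
      have hm2 : alpha * n < m + 1 := Nat.lt_floor_add_one _
      have hm0 : 0 < m := by
        have : (0 : ℝ) < m := by nlinarith
        exact_mod_cast this
      have hmn : m < n := by
        have : (m : ℝ) < n := by nlinarith
        exact_mod_cast this
      obtain ⟨b, hb⟩ := Nat.exists_eq_add_of_lt hmn
      have hb' : n = m + (b + 1) := by omega
      have hbR : (n : ℝ) = m + ((b + 1 : ℕ) : ℝ) := by exact_mod_cast hb'
      have h1 := log_blockValue_add_log_v_le m (Nat.succ_pos b)
      rw [Nat.succ_eq_add_one, ← hb'] at h1
      have h2 := ih m hmn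
      have h3 := blockIntegral_le m (b + 1) hm0
      rw [blockIntegral_eq _ _ (by rw [← hbR]; linarith), ← hbR] at h3
      have hn0 : (0 : ℝ) < n := by linarith
      have hx1 : alpha - 1 / n ≤ m / n := by
        rw [le_div_iff₀ hn0, sub_mul, one_div, inv_mul_cancel₀ hn0.ne']
        linarith
      have hx2 : (m / n : ℝ) ≤ alpha := by rwa [div_le_iff₀ hn0]
      have hinv : (1 / n : ℝ) ≤ 1 / 20 := one_div_le_one_div_of_le (by norm_num) hn'
      have h4 := gammaConst_mul_sub_f_le (x := m / n) (by linarith) hx2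
      have h5 : gammaConst * (1 - (m / n : ℝ) ^ 2) - f (m / n) ≤ 1 / 2 * (1 / n) := by linarith
      have h6 := mul_le_mul_of_nonneg_left h5 (sq_nonneg (n : ℝ))
      have e1 : (n : ℝ) ^ 2 * (gammaConst * (1 - (m / n : ℝ) ^ 2) - f (m / n)) =
          gammaConst * ((n : ℝ) ^ 2 - (m : ℝ) ^ 2) - (n : ℝ) ^ 2 * f (m / n) := by
        field_simp
      have e2 : (n : ℝ) ^ 2 * (1 / 2 * (1 / n)) = n / 2 := by
        field_simp
      rw [e1, e2] at h6
      have h7 : 5 * (m : ℝ) + 1 ≤ 5 / 2 * n := by nlinarith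
      linarith

/-! ### The shape of nearly optimal layered permutations -/

/-- Blocks are dropped until the first one whose ratio is close to `α`; each dropped block costs a
fixed proportion of the decrease of the square of the size. -/
theorem exists_good_block {c η : ℝ}
    (hc : ∀ x ∈ Set.Icc (0 : ℝ) 1, η ≤ |x - alpha| → f x ≤ (gammaConst - c) * (1 - x ^ 2))
    {L : List ℕ} (hL : ∀ b ∈ L, 0 < b) :
    (∃ (P : List ℕ) (b : ℕ) (T : List ℕ), L = P ++ b :: T ∧
      |((T.sum : ℕ) / ((T.sum : ℕ) + b) : ℝ) - alpha| < η ∧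
      Real.log (listValue L) ≤ Real.log (listValue (b :: T)) +
        (gammaConst - c) * ((L.sum : ℝ) ^ 2 - (((T.sum : ℕ) : ℝ) + b) ^ 2)) ∨
    Real.log (listValue L) ≤ (gammaConst - c) * (L.sum : ℝ) ^ 2 := by
  induction L with
  | nil => right; simp [listValue]
  | cons b L ih =>
    by_cases hη : |(L.sum / (L.sum + b) : ℝ) - alpha| < η
    · refine Or.inl ⟨[], b, L, rfl, hη, ?_⟩
      rw [List.sum_cons, Nat.cast_add, add_comm (b : ℝ), sub_self, mul_zero, add_zero]
    · have hb := hL b (by simp)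
      have h1 := log_blockValue_le_of_f_le (m := L.sum) (b := b) (by omega)
        (hc _ (div_add_mem_Icc _ _) (not_lt.1 hη))
      have e : (((b :: L).sum : ℕ) : ℝ) = L.sum + b := by
        rw [List.sum_cons, Nat.cast_add, add_comm]
      rcases ih fun x hx => hL x (by simp [hx]) with ⟨P, b', T, hPT, hb', h⟩ | h
      · refine Or.inl ⟨b :: P, b', T, by rw [hPT]; rfl, hb', ?_⟩
        rw [log_listValue_cons, e]
        linarith
      · right
        rw [log_listValue_cons, e]
        linarith

theorem log_blockValue_le_sq_mul_log (m b : ℕ) :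
    Real.log (blockValue m b) ≤ (b : ℝ) ^ 2 * Real.log (m + 1) := by
  have hlog : 0 ≤ Real.log ((m : ℝ) + 1) := Real.log_nonneg (by linarith [(Nat.cast_nonneg m : (0 : ℝ) ≤ m)])
  induction b with
  | zero => simp [blockValue]
  | succ b ih =>
    rw [log_blockValue_succ]
    have hsum : ∑ i ∈ Finset.range b, (Real.log (2 * m + b + i + 1) - Real.log (b + i + 1 : ℝ)) ≤
        b * Real.log (m + 1) := by
      refine (Finset.sum_le_card_nsmul _ _ (Real.log ((m : ℝ) + 1)) fun i hi => ?_).trans_eq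
        (by rw [Finset.card_range, nsmul_eq_mul])
      have hb : (1 : ℝ) ≤ b := by
        have := Finset.mem_range.1 hi
        exact_mod_cast (by omega : 1 ≤ b)
      have hi0 : (0 : ℝ) ≤ i := Nat.cast_nonneg i
      have hm0 : (0 : ℝ) ≤ m := Nat.cast_nonneg m
      rw [sub_le_iff_le_add, ← Real.log_mul (by positivity) (by positivity)]
      refine Real.log_le_log (by positivity) ?_
      nlinarith [mul_nonneg hm0 (by linarith : (0 : ℝ) ≤ b + i - 1)]
    push_cast
    nlinarith [mul_nonneg (by positivity : (0 : ℝ) ≤ b + 1) hlog]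

theorem log_listValue_append_le {P : List ℕ} (hP : ∀ b ∈ P, 0 < b) (Q : List ℕ) :
    Real.log (listValue (P ++ Q)) ≤
      Real.log (listValue Q) + (P.sum : ℝ) ^ 2 * Real.log ((P ++ Q).sum : ℕ) := by
  induction P with
  | nil => simp
  | cons b P ih =>
    have hb := hP b (by simp)
    have ih' := ih fun x hx => hP x (by simp [hx])
    have h1 := log_blockValue_le_sq_mul_log (P ++ Q).sum b
    have e : ((b :: P) ++ Q).sum = b + (P ++ Q).sum := by simp
    rw [List.cons_append, log_listValue_cons, ← List.cons_append, e, List.sum_cons]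
    set k := (P ++ Q).sum
    have h2 : Real.log (k + 1) ≤ Real.log ((b + k : ℕ) : ℝ) := by
      refine Real.log_le_log (by positivity) ?_
      exact_mod_cast (by omega : k + 1 ≤ b + k)
    have h3 : Real.log k ≤ Real.log (k + 1) := by
      rcases Nat.eq_zero_or_pos k with hk | hk
      · simp [hk]
      · exact Real.log_le_log (by exact_mod_cast hk) (by linarith)
    have h4 : 0 ≤ Real.log ((b + k : ℕ) : ℝ) := by
      refine Real.log_nonneg ?_
      exact_mod_cast (by omega : 1 ≤ b + k)
    have h5 := mul_le_mul_of_nonneg_left h2 (sq_nonneg (b : ℝ))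
    have h6 := mul_le_mul_of_nonneg_left (h3.trans h2) (sq_nonneg (P.sum : ℝ))
    have h7 : 0 ≤ 2 * ((b : ℝ) * P.sum) * Real.log ((b + k : ℕ) : ℝ) := by positivity
    rw [Nat.cast_add b P.sum]
    linear_combination ih' + h1 + h5 + h6 + h7

theorem log_blockValue_le_of_le (m : ℕ) {b b' : ℕ} (h : b ≤ b') :
    Real.log (blockValue m b) ≤ Real.log (blockValue m b') := by
  induction b', h using Nat.le_induction with
  | base => exact le_rfl
  | succ b' _ ih =>
    rw [log_blockValue_succ]
    refine ih.trans (le_add_of_nonneg_right (Finset.sum_nonneg fun i _ => ?_))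
    exact sub_nonneg.2 (Real.log_le_log (by positivity)
      (by linarith [(Nat.cast_nonneg m : (0 : ℝ) ≤ m)]))

/-- Enlarging a block multiplies its value by an exponential in the size. -/
theorem log_blockValue_add_le {m b s : ℕ} (hs : 0 < s) :
    Real.log (blockValue m b) + b * (m / (m + b)) ≤ Real.log (blockValue m (b + s)) := by
  refine le_trans ?_ (log_blockValue_le_of_le m (show b + 1 ≤ b + s by omega))
  rw [log_blockValue_succ]
  refine add_le_add le_rfl ?_
  refine le_trans ?_ (Finset.card_nsmul_le_sum _ _ (m / (m + b) : ℝ) fun i hi => ?_)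
  · rw [Finset.card_range, nsmul_eq_mul]
  · have hib : (i : ℝ) + 1 ≤ b := by exact_mod_cast Finset.mem_range.1 hi
    have hi0 : (0 : ℝ) ≤ i := Nat.cast_nonneg i
    have hm0 : (0 : ℝ) ≤ m := Nat.cast_nonneg m
    have hb0 : (0 : ℝ) < b := by linarith
    rw [← Real.log_div (by positivity) (by positivity)]
    refine le_trans ?_ (Real.one_sub_inv_le_log_of_pos (by positivity))
    have e : 1 - ((2 * (m : ℝ) + b + i + 1) / (b + i + 1))⁻¹ = 2 * m / (2 * m + b + i + 1) := by
      field_simp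
      ring
    rw [e, div_le_div_iff₀ (by positivity) (by positivity)]
    nlinarith

/-- In a nearly optimal list the first block has size about `(1 - α) n`. Only a bounded amount of
mass precedes the first block with a good ratio, and merging this mass into that block gains a
factor that is exponential in `n`. -/
theorem first_block_of_nearly_optimal {η : ℝ} (hη : 0 < η) :
    ∀ᶠ n : ℕ in atTop, ∀ L : List ℕ, (∀ b ∈ L, 0 < b) → L.sum = n →
      Real.log (v n) - Real.log (listValue L) ≤ 1 / 10 * n →
      |((L.getD 0 0 : ℕ) : ℝ) - (1 - alpha) * n| ≤ η * n := by
  obtain ⟨c, hc0, hc⟩ := exists_f_le_sub_mul (η := min η (1 / 100)) (by positivity)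
  set C := 5 / c with hC
  have hC0 : 0 < C := by positivity
  have hlog : ∀ᶠ n : ℕ in atTop, C ^ 2 * Real.log n ≤ 1 / 20 * n := by
    have h := (Real.isLittleO_log_id_atTop.comp_tendsto tendsto_natCast_atTop_atTop).def
      (show 0 < 1 / 20 / C ^ 2 by positivity)
    filter_upwards [h] with n hn
    simp only [Function.comp, id, Real.norm_eq_abs, Nat.abs_cast] at hn
    have h1 := (le_abs_self _).trans hn
    rw [div_mul_eq_mul_div, le_div_iff₀ (by positivity)] at h1
    linarith
  have hbig : ∀ᶠ n : ℕ in atTop, 20 * C + 1 ≤ (n : ℝ) :=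
    tendsto_natCast_atTop_atTop.eventually_ge_atTop _
  filter_upwards [hlog, hbig] with n hn1 hn2 L hL hLn hopt
  have hn0 : (0 : ℝ) < n := by linarith
  have hlow := le_log_v n
  rcases exists_good_block hc hL with ⟨P, b, T, hPT, hb, h⟩ | h
  · have hPpos : ∀ x ∈ P, 0 < x := fun x hx => hL x (by rw [hPT]; exact List.mem_append_left _ hx)
    have hTpos : ∀ x ∈ b :: T, 0 < x := fun x hx =>
      hL x (by rw [hPT]; exact List.mem_append_right _ hx)
    have hb0 : 0 < b := hTpos b (by simp)
    obtain ⟨s, hs⟩ : ∃ s, s = P.sum := ⟨_, rfl⟩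
    obtain ⟨m, hm⟩ : ∃ m, m = T.sum := ⟨_, rfl⟩
    have hsum : n = s + (m + b) := by
      rw [← hLn, hPT, List.sum_append, List.sum_cons, hs, hm]; ring
    have hsumR : (n : ℝ) = s + (m + b) := by exact_mod_cast hsum
    rw [← hm, hLn] at h
    rw [← hm] at hb
    have hk0 : (0 : ℝ) < m + b := by positivity
    have hs0 : (0 : ℝ) ≤ s := Nat.cast_nonneg s
    have hup := log_listValue_le hTpos
    rw [show (((b :: T).sum : ℕ) : ℝ) = m + b by rw [List.sum_cons, hm, Nat.cast_add, add_comm]] at hup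
    have hsq : c * ((n : ℝ) ^ 2 - (m + b : ℝ) ^ 2) ≤ 5 * n := by linarith
    have hsC : (s : ℝ) ≤ C := by
      rw [hC, le_div_iff₀ hc0]
      have h1 : c * (s * n) ≤ c * ((n : ℝ) ^ 2 - (m + b : ℝ) ^ 2) := by
        refine mul_le_mul_of_nonneg_left ?_ hc0.le
        rw [hsumR]
        nlinarith
      have h2 : s * c * n ≤ 5 * n := by linarith
      exact le_of_mul_le_mul_right h2 hn0
    rcases Nat.eq_zero_or_pos s with hs' | hs'
    · have hP : P = [] := by
        rcases P with _ | ⟨p, P⟩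
        · rfl
        · have := hPpos p (by simp)
          rw [List.sum_cons] at hs
          omega
      subst hP
      rw [hPT, List.nil_append, List.getD_cons_zero]
      have hn' : (n : ℝ) = m + b := by rw [hsumR, hs']; simp
      have h1 : |(m / (m + b) : ℝ) - alpha| ≤ η := hb.le.trans (min_le_left _ _)
      rw [← hn'] at h1
      have h2 : (b : ℝ) - (1 - alpha) * n = -((m / n - alpha) * n) := by
        field_simp
        rw [hn']
        ring
      rw [h2, abs_neg, abs_mul, abs_of_pos hn0]
      exact mul_le_mul_of_nonneg_right h1 hn0.le
    · exfalso
      have hv := log_listValue_le_log_v (L := (b + s) :: T) (fun x hx => by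
        rcases List.mem_cons.1 hx with rfl | hx
        · omega
        · exact hTpos x (by simp [hx]))
      rw [log_listValue_cons, List.sum_cons, ← hm, show b + s + m = n by omega] at hv
      have hgain := log_blockValue_add_le (m := m) (b := b) hs'
      have happ := log_listValue_append_le hPpos (b :: T)
      rw [← hPT, hLn, log_listValue_cons, ← hm, ← hs] at happ
      have hlogn : 0 ≤ Real.log n := Real.log_nonneg (by linarith)
      have hsq' : (s : ℝ) ^ 2 * Real.log n ≤ C ^ 2 * Real.log n := by gcongr
      set x : ℝ := m / (m + b) with hx
      have hx' : |x - alpha| < 1 / 100 := hb.trans_le (min_le_right _ _)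
      rw [abs_lt] at hx'
      have ha0 := lt_alpha
      have ha1 := alpha_lt
      norm_num at ha0 ha1
      have hbx : (b : ℝ) = (m + b) * (1 - x) := by
        rw [hx]
        field_simp
        ring
      have h1 : 1 / 5 ≤ (1 - x) * x := by nlinarith
      have h2 : 1 / 5 * (m + b : ℝ) ≤ b * x := by
        rw [hbx]
        nlinarith
      linarith
  · exfalso
    rw [hLn] at h
    have h1 : c * (n : ℝ) * n ≤ 5 * n := by nlinarith
    have h2 := le_of_mul_le_mul_right h1 hn0
    have h3 : (n : ℝ) ≤ C := by
      rw [hC, le_div_iff₀ hc0]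
      linarith
    linarith

/-- Induction on `i`: the blocks after the first one form a nearly optimal list of size about `α n`. -/
theorem blocks_of_nearly_optimal (i : ℕ) : ∀ η > 0, ∃ δ > 0, ∀ᶠ n : ℕ in atTop, ∀ L : List ℕ,
    (∀ b ∈ L, 0 < b) → L.sum = n → Real.log (v n) - Real.log (listValue L) ≤ δ * n →
      |((L.getD i 0 : ℕ) : ℝ) - alpha ^ i * (1 - alpha) * n| ≤ η * n := by
  have ha0 := alpha_pos
  have ha1 := alpha_lt_one
  induction i with
  | zero =>
    intro η hη
    refine ⟨1 / 10, by norm_num, ?_⟩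
    simpa using first_block_of_nearly_optimal hη
  | succ i ih =>
    intro η hη
    obtain ⟨δ, hδ, hev⟩ := ih (η / 2) (by linarith)
    obtain ⟨N, hN⟩ := eventually_atTop.1 hev
    have hη' : 0 < min (η / 2) (1 / 10) := by positivity
    refine ⟨min (1 / 10) (δ / 5), by positivity, ?_⟩
    filter_upwards [first_block_of_nearly_optimal hη', eventually_ge_atTop (5 * N + 1)]
      with n hfirst hn L hL hLn hopt
    have hn0 : (0 : ℝ) < n := by exact_mod_cast (by omega : 0 < n)
    have hb := hfirst L hL hLn (hopt.trans (by gcongr; exact min_le_left _ _))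
    rcases L with _ | ⟨b, T⟩
    · simp at hLn
      omega
    rw [List.getD_cons_zero] at hb
    rw [List.getD_cons_succ]
    obtain ⟨m, hm⟩ : ∃ m, m = T.sum := ⟨_, rfl⟩
    have hnm : n = m + b := by rw [← hLn, List.sum_cons, hm]; ring
    have hnR : (n : ℝ) = m + b := by exact_mod_cast hnm
    have hmα : |(m : ℝ) - alpha * n| ≤ min (η / 2) (1 / 10) * n := by
      rw [show (m : ℝ) - alpha * n = -(b - (1 - alpha) * n) by rw [hnR]; ring, abs_neg]
      exact hb
    have hm1 : |(m : ℝ) - alpha * n| ≤ η / 2 * n :=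
      hmα.trans (mul_le_mul_of_nonneg_right (min_le_left _ _) hn0.le)
    have hm2 : |(m : ℝ) - alpha * n| ≤ 1 / 10 * n :=
      hmα.trans (mul_le_mul_of_nonneg_right (min_le_right _ _) hn0.le)
    have hmn : (n : ℝ) ≤ 5 * m := by
      have := (abs_le.1 hm2).1
      have hα := lt_alpha
      norm_num at hα
      nlinarith
    have hmN : N ≤ m := by
      have : n ≤ 5 * m := by exact_mod_cast hmn
      omega
    have hmle : (m : ℝ) ≤ n := by rw [hnR]; linarith [(Nat.cast_nonneg b : (0 : ℝ) ≤ b)]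
    -- removing the first block does not increase the distance to the optimum
    have hdef : Real.log (v m) - Real.log (listValue T) ≤ δ * m := by
      have h1 := log_blockValue_add_log_v_le m (hL b (by simp))
      rw [← hnm] at h1
      rw [log_listValue_cons, ← hm] at hopt
      have h2 : min (1 / 10) (δ / 5) * n ≤ δ / 5 * n :=
        mul_le_mul_of_nonneg_right (min_le_right _ _) hn0.le
      nlinarith
    have hT := hN m hmN T (fun x hx => hL x (by simp [hx])) hm.symm hdef
    set p := alpha ^ i * (1 - alpha) with hp
    have hp0 : 0 ≤ p := mul_nonneg (by positivity) (by linarith)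
    have hp1 : p ≤ 1 := mul_le_one₀ (pow_le_one₀ ha0.le ha1.le) (by linarith) (by linarith)
    have e : ((T.getD i 0 : ℕ) : ℝ) - alpha ^ (i + 1) * (1 - alpha) * n =
        (((T.getD i 0 : ℕ) : ℝ) - p * m) + p * (m - alpha * n) := by
      rw [hp]; ring
    rw [e]
    refine (abs_add_le _ _).trans ?_
    rw [abs_mul, abs_of_nonneg hp0]
    have h3 : p * |(m : ℝ) - alpha * n| ≤ 1 * |(m : ℝ) - alpha * n| :=
      mul_le_mul_of_nonneg_right hp1 (abs_nonneg _)
    have h4 : η / 2 * m ≤ η / 2 * n := by gcongr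
    linarith

theorem run_isEquivalent {c : (n : ℕ) → Composition n}
    (hc : (fun n : ℕ => Real.log (v n : ℝ) - Real.log (upsilon (layeredPerm (c n)) : ℝ))
      =o[atTop] (fun n : ℕ => (n : ℝ))) (i : ℕ) :
    (fun n : ℕ => (run (c n) i : ℝ)) ~[atTop] fun n : ℕ => alpha ^ i * (1 - alpha) * (n : ℝ) := by
  have hp : 0 < alpha ^ i * (1 - alpha) :=
    mul_pos (pow_pos alpha_pos i) (by linarith [alpha_lt_one])
  rw [IsEquivalent, isLittleO_iff]
  intro ε hε
  obtain ⟨δ, hδ, hev⟩ := blocks_of_nearly_optimal i (ε * (alpha ^ i * (1 - alpha))) (by positivity)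
  filter_upwards [hev, hc.def hδ] with n hn hopt
  have h := hn (c n).blocks.reverse (fun b hb => (c n).blocks_pos (List.mem_reverse.1 hb))
    (by rw [List.sum_reverse, (c n).blocks_sum]) (by
      rw [← upsilon_layeredPerm]
      simp only [Real.norm_eq_abs, Nat.abs_cast] at hopt
      exact (le_abs_self _).trans hopt)
  simp only [Pi.sub_apply, Real.norm_eq_abs]
  rw [abs_of_nonneg (by positivity : 0 ≤ alpha ^ i * (1 - alpha) * (n : ℝ)), ← mul_assoc]
  exact h

theorem tendsto_logb_v :
    Tendsto (fun n : ℕ => 1 / (n : ℝ) ^ 2 * Real.logb 2 (v n : ℝ)) atTop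
      (𝓝 (gammaConst / Real.log 2)) := by
  have hlog : 0 < Real.log 2 := Real.log_pos one_lt_two
  have h1 : Tendsto (fun n : ℕ => 4 / Real.log 2 / (n : ℝ)) atTop (𝓝 0) :=
    tendsto_const_div_atTop_nhds_zero_nat _
  have h2 : Tendsto (fun n : ℕ => gammaConst / Real.log 2 - 4 / Real.log 2 / (n : ℝ)) atTop
      (𝓝 (gammaConst / Real.log 2)) := by
    simpa using h1.const_sub (gammaConst / Real.log 2)
  refine tendsto_of_tendsto_of_tendsto_of_le_of_le' h2 tendsto_const_nhds ?_ ?_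
  · filter_upwards [eventually_gt_atTop 0] with n hn
    have hn0 : (0 : ℝ) < n := by exact_mod_cast hn
    have h := le_log_v n
    rw [Real.logb, one_div_mul_eq_div, div_div (Real.log _),
      le_div_iff₀ (mul_pos hlog (pow_pos hn0 2))]
    refine le_trans (le_of_eq ?_) h
    field_simp
  · filter_upwards [eventually_gt_atTop 0] with n hn
    have hn0 : (0 : ℝ) < n := by exact_mod_cast hn
    have h := log_v_le n
    rw [Real.logb, one_div_mul_eq_div, div_div, div_le_div_iff₀ (by positivity) hlog]
    nlinarith

end LayeredSchubert

end

theorem theorem1p3 :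
    ∃ α γ : ℝ,
      -- `α` is the unique root in `(0,1)` of `2 x f(x) + (1 - x²) f'(x)`
      (0 < α ∧ α < 1) ∧
      2 * α * LayeredSchubert.f α + (1 - α ^ 2) * deriv LayeredSchubert.f α = 0 ∧
      (∀ x : ℝ, 0 < x → x < 1 →
        2 * x * LayeredSchubert.f x + (1 - x ^ 2) * deriv LayeredSchubert.f x = 0 → x = α) ∧
      γ = LayeredSchubert.f α / (1 - α ^ 2) ∧
      -- numerical values
      |α - 0.4331818312| < 1 / 10 ^ 10 ∧
      |γ - 0.2032558981| < 1 / 10 ^ 10 ∧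
      |γ / Real.log 2 - 0.2932362762| < 1 / 10 ^ 10 ∧
      -- the limit
      Tendsto (fun n : ℕ => 1 / (n : ℝ) ^ 2 * Real.logb 2 (LayeredSchubert.v n : ℝ)) atTop
        (𝓝 (γ / Real.log 2)) ∧
      -- the quantitative form
      (∀ n : ℕ, 1 ≤ n → |Real.log (LayeredSchubert.v n : ℝ) - γ * (n : ℝ) ^ 2| ≤ 4 * (n : ℝ)) ∧
      -- the runs of maximizing layered permutations
      (∀ c : (n : ℕ) → Composition n,
        (∀ n, LayeredSchubert.upsilon (LayeredSchubert.layeredPerm (c n)) = LayeredSchubert.v n) →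
        ∀ i : ℕ, (fun n : ℕ => (LayeredSchubert.run (c n) i : ℝ)) ~[atTop]
          fun n : ℕ => α ^ i * (1 - α) * (n : ℝ)) ∧
      -- the runs of layered permutations that are maximizing up to a factor `exp (o(n))`
      (∀ c : (n : ℕ) → Composition n,
        (fun n : ℕ => Real.log (LayeredSchubert.v n : ℝ) -
          Real.log (LayeredSchubert.upsilon (LayeredSchubert.layeredPerm (c n)) : ℝ))
            =o[atTop] (fun n : ℕ => (n : ℝ)) →
        ∀ i : ℕ, (fun n : ℕ => (LayeredSchubert.run (c n) i : ℝ)) ~[atTop]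
          fun n : ℕ => α ^ i * (1 - α) * (n : ℝ)) := by
  have hderiv : ∀ x : ℝ, 0 < x → x < 1 → LayeredSchubert.critFun x =
      2 * x * LayeredSchubert.f x + (1 - x ^ 2) * deriv LayeredSchubert.f x := fun x h0 h1 => by
    rw [(LayeredSchubert.hasDerivAt_f h0 h1).deriv, LayeredSchubert.critFun_eq]
  exact ⟨LayeredSchubert.alpha, LayeredSchubert.gammaConst,
    ⟨LayeredSchubert.alpha_pos, LayeredSchubert.alpha_lt_one⟩,
    (hderiv _ LayeredSchubert.alpha_pos LayeredSchubert.alpha_lt_one).symm.trans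
      LayeredSchubert.critFun_alpha,
    fun x h0 h1 h => LayeredSchubert.eq_alpha_of_critFun_eq_zero h0 h1 ((hderiv x h0 h1).trans h),
    rfl, LayeredSchubert.abs_alpha_sub_lt, LayeredSchubert.gammaConst_bounds.2.2.1,
    LayeredSchubert.gammaConst_bounds.2.2.2, LayeredSchubert.tendsto_logb_v,
    fun n _ => abs_le.2 ⟨by linarith [LayeredSchubert.le_log_v n],
      by linarith [LayeredSchubert.log_v_le n, (Nat.cast_nonneg n : (0 : ℝ) ≤ n)]⟩,
    fun c hc i => LayeredSchubert.run_isEquivalent (by simp [hc]) i,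
    fun c hc i => LayeredSchubert.run_isEquivalent hc i⟩
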